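/- **Setting.** An MDP with states $S$ and actions $A$ is a Markov kernel giving the joint law of the reward and the next state from $(s,a)$; rewards satisfy $|r|\le r_{\max}$, and the discount factor is $\gamma\in[0,1)$. Let $\beta(a\mid s,z)$ be a low-level primitive with skills $z\in Z$, and let $c\ge 1$. The *hyper-MDP* has states $S$, actions $Z$, and discount $\gamma^c$; one of its steps from $(s,z)$ follows $\beta(\cdot\mid\cdot,z)$ for $c$ steps of the base MDP, collects $R=\sum_{i=0}^{c-1}\gamma^i r_i$, and moves to the state reached. Its rewards are bounded by $r'_{\max}=\frac{1-\gamma^c}{1-\gamma}r_{\max}$. For a high-level policy $\pi(z\mid s)$, write $J(\pi_\beta)$ for its expected discounted return in the hyper-MDP from the initial state $s$. An MDP with reward bound $\rho$ is a *linear MDP* with measurable feature map $\Phi$ into $\mathbb R^d$, $\|\Phi\|_2\le 1$, if there are an $\mathbb R^d$-valued vector measure $\mu$ on $S$ with $\|\mu(B)\|_2\le\sqrt d$ for all measurable $B$, and $\theta\in\mathbb R^d$ with $\|\theta\|_2\le\sqrt d\,\rho$, such that $P(B\mid s,a)=\langle\Phi(s,a),\mu(B)\rangle$ and $\mathbb E[r\mid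 s,a]=\langle\Phi(s,a),\theta\rangle$. Let the data $\mathcal D=\{(s_\tau,z_\tau,R_\tau,s'_\tau)\}_{\tau=1}^N$, $N\ge1$, be collected in the hyper-MDP: given all earlier transitions and $(s_\tau,z_\tau)$, the pair $(R_\tau,s'_\tau)$ follows the hyper-MDP law at $(s_\tau,z_\tau)$. *Pessimistic value iteration* (PEVI) with parameters $\lambda,b>0$ uses $\Lambda=\lambda I+\sum_\tau\Phi(s_\tau,z_\tau)\Phi(s_\tau,z_\tau)^\top$ and, for a value estimate $V$, $$\widehat Q_V(s,z)=\Phi(s,z)^\top\Lambda^{-1}\sum_{\tau=1}^N\Phi(s_\tau,z_\tau)\bigl(R_\tau+\gamma^cV(s'_\tau)\bigr)-b\,\bigl(\Phi(s,z)^\top\Lambda^{-1}\Phi(s,z)\bigr)^{1/2}.$$ Starting from $V_0=0$, each round takes a policy $\pi_k$ maximizing $\mathbb E_{\pi}[\widehat Q_{V_k}]$ at every state and puts $V_{k+1}=\mathbb E_{\pi_k}[\widehat Q_{V_k}]$. When $V_k$ converges pointwise to some $\widehat V$, the algorithm returns a policy $\widehat\pi$ that is greedy for $\widehat Q_{\widehat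 V}$. **Statement.** (1) There is an absolute constant $C>0$ with the following property. Suppose the hyper-MDP is a linear MDP with feature map $\Phi:S\times Z\to\mathbb R^d$ and reward bound $r'_{\max}$. Let $\pi^*$ be an optimal policy of the hyper-MDP, let $\delta\in(0,1)$, and put $$\Sigma_{\mathcal D}=\frac1N\sum_{\tau=1}^N\Phi(s_\tau,z_\tau)\Phi(s_\tau,z_\tau)^\top,\qquad \Sigma_{\pi^*,s}=\mathbb E_{\pi^*}\bigl[\Phi\Phi^\top\mid s_0=s\bigr],$$ the latter expectation being over the normalized discounted occupancy measure $(1-\gamma^c)\sum_{t\ge0}\gamma^{ct}\,\mathbb P(s_t,z_t)$ of $\pi^*$ from $s$. Suppose there is a finite constant $c^\dagger$ such that, with probability at least $1-\delta/2$, $$\sup_{x\in\mathbb R^d}\frac{x^\top\Sigma_{\pi^*,s}x}{x^\top\Sigma_{\mathcal D}x}\le c^\dagger\quad\text{for all }s\in S$$ (with $a/0=\infty$ for $a>0$ and $0/0=0$). Run PEVI on the hyper-MDP with $$\lambda=1,\qquad b=\frac{C\,d\,r'_{\max}\sqrt\zeta}{1-\gamma^c}=\frac{C\,d\,r_{\max}\sqrt\zeta}{1-\gamma},\qquad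 \zeta=\log\frac{4dN}{(1-\gamma^c)\delta}.$$ Then with probability at least $1-\delta$, every policy $\widehat\pi$ returned by PEVI satisfies, from every initial state $s\in S$, $$J(\pi^*_\beta)-J(\widehat\pi_\beta)\le\frac{2C\,r_{\max}}{(1-\gamma)(1-\gamma^c)}\sqrt{\frac{c^\dagger d^3\zeta}{N}}.$$ (2) If the base MDP is a linear MDP with feature map $\varphi:S\times A\to\mathbb R^{m}$ and reward bound $r_{\max}$, then the hyper-MDP is a linear MDP with reward bound $r'_{\max}$ and the $2m$-dimensional feature map $$(s,z)\mapsto\tfrac1{\sqrt2}\Bigl(\mathbb E[\varphi(s_{c-1},a_{c-1})],\ \tfrac{1-\gamma}{1-\gamma^c}\sum_{k=0}^{c-1}\gamma^k\,\mathbb E[\varphi(s_k,a_k)]\Bigr),$$ where the expectations follow $\beta(\cdot\mid\cdot,z)$ from $s_0=s$; so (1) applies with $d=2m$. -/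

import Mathlib

open MeasureTheory ProbabilityTheory Filter Topology
open scoped ENNReal NNReal

noncomputable section

namespace HierRL

/-- A Markov decision process with states `S` and actions `A`: `step (s, a)` is the joint law of
the (possibly random) reward and of the next state. The discount factor is kept separate. -/
structure MDP (S A : Type*) [MeasurableSpace S] [MeasurableSpace A] where
  /-- joint law of (reward, next state) -/
  step : Kernel (S × A) (ℝ × S)
  /-- it is a probability law -/
  markov : IsMarkovKernel step

attribute [instance] MDP.markov

namespace MDP

variable {S A : Type*} [MeasurableSpace S] [MeasurableSpace A]

/-- All rewards lie in `[-rmax, rmax]`. -/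
def RewardBounded (M : MDP S A) (rmax : ℝ) : Prop :=
  ∀ q : S × A, ∀ᵐ p ∂(M.step q), |p.1| ≤ rmax

/-- The expected reward `r(s, a)`. -/
def meanReward (M : MDP S A) (q : S × A) : ℝ := ∫ p, p.1 ∂(M.step q)

/-- From a state, draw an action from the policy and keep the pair. -/
def act (π : Kernel S A) : Kernel S (S × A) := Kernel.id ×ₖ π

/-- `M.visit π t s` is the law of `(s_t, a_t)` when `s_0 = s` and the policy `π` is followed. -/
def visit (M : MDP S A) (π : Kernel S A) : ℕ → Kernel S (S × A)
  | 0 => act π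
  | t + 1 => act π ∘ₖ (M.step.map Prod.snd ∘ₖ M.visit π t)

/-- `J(π)` from the initial state `s`: the expected discounted return `∑ γ^t E[r(s_t, a_t)]`. -/
def J (M : MDP S A) (γ : ℝ) (π : Kernel S A) (s : S) : ℝ :=
  ∑' t : ℕ, γ ^ t * ∫ q, M.meanReward q ∂(M.visit π t s)

/-- `π` is a policy of maximal return from every initial state. -/
def IsOptimal (M : MDP S A) (γ : ℝ) (π : Kernel S A) : Prop :=
  ∀ π' : Kernel S A, IsMarkovKernel π' → ∀ s, M.J γ π' s ≤ M.J γ π s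

variable {ι : Type*} [Fintype ι]

/-- `M` is a linear MDP with feature map `Φ` (of dimension `d = Fintype.card ι`): there are
measures `μ = (μ_i)` on `S` (a vector measure) and a vector `θ` with
`P(B | s, a) = ⟨Φ(s, a), μ(B)⟩` and `r(s, a) = ⟨Φ(s, a), θ⟩`, normalised by `‖Φ‖ ≤ 1`,
`‖μ(B)‖ ≤ √d` and `‖θ‖ ≤ √d * rmax`. -/
def IsLinear (M : MDP S A) (Φ : S × A → EuclideanSpace ℝ ι) (rmax : ℝ) : Prop :=
  Measurable Φ ∧ (∀ q, ‖Φ q‖ ≤ 1) ∧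
  (∃ μ : VectorMeasure S (EuclideanSpace ℝ ι),
    (∀ B, MeasurableSet B → ‖μ B‖ ≤ √(Fintype.card ι)) ∧
    ∀ q B, MeasurableSet B → (M.step q).real (Prod.snd ⁻¹' B) = inner ℝ (Φ q) (μ B)) ∧
  ∃ θ : EuclideanSpace ℝ ι, ‖θ‖ ≤ √(Fintype.card ι) * rmax ∧
    ∀ q, M.meanReward q = inner ℝ (Φ q) θ

/-- `Σ_{π,s} = E_π[Φ(s_t, a_t) Φ(s_t, a_t)ᵀ | s_0 = s]`, where `(s_t, a_t)` is drawn from the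
normalised discounted occupancy measure `(1 - γ) ∑ γ^t P(s_t, a_t)` of `π` started at `s`. -/
def policyCov (M : MDP S A) (γ : ℝ) (Φ : S × A → EuclideanSpace ℝ ι) (π : Kernel S A) (s : S) :
    Matrix ι ι ℝ :=
  Matrix.of fun i j => (1 - γ) * ∑' t : ℕ, γ ^ t * ∫ q, Φ q i * Φ q j ∂(M.visit π t s)

end MDP

section Hyper

variable {S A Z : Type*} [MeasurableSpace S] [MeasurableSpace A] [MeasurableSpace Z]

/-- One step of `M` in which the action is drawn from the low-level primitive `b(· | s, z)`. -/
def primStep (M : MDP S A) (b : Kernel (S × Z) A) : Kernel (S × Z) (ℝ × S) :=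
  M.step ∘ₖ (Kernel.deterministic Prod.fst measurable_fst ×ₖ b)

/-- The law, from `(s, z)`, of `(∑_{i<n} γ^i r_i, s_n)` when the primitive `b(· | ·, z)` is
followed for `n` steps in `M` with the skill `z` held fixed. -/
def rollout (M : MDP S A) (b : Kernel (S × Z) A) (γ : ℝ) : ℕ → Kernel (S × Z) (ℝ × S)
  | 0 => Kernel.deterministic (fun q => ((0 : ℝ), q.1)) (by fun_prop)
  | n + 1 =>
    (primStep M b ⊗ₖ
      (rollout M b γ n).comap (fun p : (S × Z) × (ℝ × S) => (p.2.2, p.1.2)) (by fun_prop)).map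
      (fun q : (ℝ × S) × (ℝ × S) => (q.1.1 + γ * q.2.1, q.2.2))

instance primStep_markov (M : MDP S A) (b : Kernel (S × Z) A) [IsMarkovKernel b] :
    IsMarkovKernel (primStep M b) := by
  unfold primStep; infer_instance

instance rollout_markov (M : MDP S A) (b : Kernel (S × Z) A) [IsMarkovKernel b] (γ : ℝ) (n : ℕ) :
    IsMarkovKernel (rollout M b γ n) := by
  induction n with
  | zero => unfold rollout; infer_instance
  | succ n ih => unfold rollout; exact Kernel.IsMarkovKernel.map _ (by fun_prop)

/-- The hyper-MDP: its actions are the skills `z`, and one of its steps is `c` steps of `M` under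
the primitive `b`. Its discount factor is `γ ^ c`. -/
def hyper (M : MDP S A) (b : Kernel (S × Z) A) [IsMarkovKernel b] (γ : ℝ) (c : ℕ) : MDP S Z where
  step := rollout M b γ c
  markov := rollout_markov M b γ c

/-- The reward bound `∑_{k<c} γ^k rmax = (1 - γ^c)/(1 - γ) rmax` of the hyper-MDP. -/
def hyperRmax (γ : ℝ) (c : ℕ) (rmax : ℝ) : ℝ := (1 - γ ^ c) / (1 - γ) * rmax

variable {ι : Type*}

/-- `E[φ(s_k, a_k)]` when the primitive `b(· | ·, z)` is followed in `M` from the state `s`. -/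
def primFeature (M : MDP S A) (b : Kernel (S × Z) A) (γ : ℝ) (φ : S × A → EuclideanSpace ℝ ι)
    (k : ℕ) (q : S × Z) (i : ι) : ℝ :=
  ∫ p, ∫ a, φ (p.2, a) i ∂(b (p.2, q.2)) ∂(rollout M b γ k q)

/-- The feature map that the hyper-MDP inherits from a feature map `φ` of `M`: the pair of the
feature `E[φ(s_{c-1}, a_{c-1})]`, which determines the law of `s_c`, and the normalised feature
`∑_{k<c} γ^k E[φ(s_k, a_k)]`, which determines the accumulated reward, divided by `√2`. -/
def hyperFeature (M : MDP S A) (b : Kernel (S × Z) A) (γ : ℝ) (c : ℕ)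
    (φ : S × A → EuclideanSpace ℝ ι) (q : S × Z) : EuclideanSpace ℝ (ι ⊕ ι) :=
  WithLp.toLp 2 (Sum.elim
    (fun i => primFeature M b γ φ (c - 1) q i / √2)
    (fun i => (1 - γ) / (1 - γ ^ c) *
      (∑ k ∈ Finset.range c, γ ^ k * primFeature M b γ φ k q i) / √2))

end Hyper

section Data

variable {S A Ω : Type*} [MeasurableSpace S] [MeasurableSpace A] [MeasurableSpace Ω] {N : ℕ}

/-- A transition `((s, a), (r, s'))`. -/
abbrev Transition (S A : Type*) := (S × A) × (ℝ × S)

/-- What is known before the outcome of the `τ`-th transition: all earlier transitions, and the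
current state-action pair. -/
abbrev past (D : Fin N → Ω → Transition S A) (τ : Fin N) : MeasurableSpace Ω :=
  (⨆ j : Fin N, ⨆ _ : j < τ, MeasurableSpace.comap (D j) inferInstance) ⊔
    MeasurableSpace.comap (fun ω => (D τ ω).1) inferInstance

/-- The dataset is collected in `M`: given the past, the outcome (reward, next state) of the
`τ`-th transition has law `M.step (s_τ, a_τ)`. The choice of the pairs `(s_τ, a_τ)` is free; it
may depend on the past in any way (independent transitions and trajectories are included). -/
structure IsDatasetOf (M : MDP S A) (P : Measure Ω) (D : Fin N → Ω → Transition S A) : Prop where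
  measurable : ∀ τ, Measurable (D τ)
  law : ∀ (τ : Fin N) (E : Set Ω) (B : Set (ℝ × S)), MeasurableSet[past D τ] E →
    MeasurableSet B → P (E ∩ {ω | (D τ ω).2 ∈ B}) = ∫⁻ ω in E, M.step (D τ ω).1 B ∂P

end Data

section PEVI

variable {S A : Type*} {N : ℕ} {ι : Type*} [Fintype ι]

/-- `Σ_D = (1/N) ∑ Φ(s_τ, a_τ) Φ(s_τ, a_τ)ᵀ`. -/
def dataCov (Φ : S × A → EuclideanSpace ℝ ι) (D : Fin N → Transition S A) : Matrix ι ι ℝ :=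
  (1 / (N : ℝ)) • ∑ τ, Matrix.vecMulVec (Φ (D τ).1).ofLp (Φ (D τ).1).ofLp

/-- `sup_x (xᵀ U x) / (xᵀ W x)` in `[0, ∞]` for positive semidefinite `U`, `W`; here `a / 0 = ∞`
for `a > 0`, and `0 / 0 = 0`. -/
def coverage (U W : Matrix ι ι ℝ) : ℝ≥0∞ :=
  ⨆ x : ι → ℝ, ENNReal.ofReal (x ⬝ᵥ U.mulVec x) / ENNReal.ofReal (x ⬝ᵥ W.mulVec x)

variable [DecidableEq ι]

/-- `Λ = lam I + ∑ Φ(s_τ, a_τ) Φ(s_τ, a_τ)ᵀ`. -/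
def gram (Φ : S × A → EuclideanSpace ℝ ι) (lam : ℝ) (D : Fin N → Transition S A) :
    Matrix ι ι ℝ :=
  lam • (1 : Matrix ι ι ℝ) + ∑ τ, Matrix.vecMulVec (Φ (D τ).1).ofLp (Φ (D τ).1).ofLp

/-- The ridge regression weight `ŵ = Λ⁻¹ ∑ Φ(s_τ, a_τ) (r_τ + γ V(s'_τ))`. -/
def ridgeWeight (γ : ℝ) (Φ : S × A → EuclideanSpace ℝ ι) (lam : ℝ) (D : Fin N → Transition S A)
    (V : S → ℝ) : ι → ℝ :=
  (gram Φ lam D)⁻¹.mulVec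
    (∑ τ, ((D τ).2.1 + γ * V (D τ).2.2) • (Φ (D τ).1).ofLp)

/-- The penalty `Γ(s, a) = β (Φ(s, a)ᵀ Λ⁻¹ Φ(s, a))^{1/2}`. -/
def penalty (Φ : S × A → EuclideanSpace ℝ ι) (lam β : ℝ) (D : Fin N → Transition S A)
    (q : S × A) : ℝ :=
  β * √((Φ q).ofLp ⬝ᵥ (gram Φ lam D)⁻¹.mulVec (Φ q).ofLp)

/-- The pessimistic estimate `Q̂ = ⟨Φ, ŵ⟩ - Γ` computed from the value estimate `V`. -/
def pessQ (γ : ℝ) (Φ : S × A → EuclideanSpace ℝ ι) (lam β : ℝ) (D : Fin N → Transition S A)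
    (V : S → ℝ) (q : S × A) : ℝ :=
  (Φ q).ofLp ⬝ᵥ ridgeWeight γ Φ lam D V - penalty Φ lam β D q

variable [MeasurableSpace S] [MeasurableSpace A]

/-- `π` is a policy that maximises `E_π[Q(s, ·)]` at every state `s`. -/
def IsGreedy (π : Kernel S A) (Q : S × A → ℝ) : Prop :=
  IsMarkovKernel π ∧ ∀ s a, Q (s, a) ≤ ∫ a', Q (s, a') ∂(π s)

/-- `π̂` is returned by pessimistic value iteration on the data `D` (discount `γ`): starting from
`V 0 = 0`, each round takes a greedy policy for `Q̂(V k)` and sets `V (k + 1) = E[Q̂(V k)]` under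
that policy; the values converge, and `π̂` is greedy for the limit. -/
def IsPEVIOutput (γ : ℝ) (Φ : S × A → EuclideanSpace ℝ ι) (lam β : ℝ)
    (D : Fin N → Transition S A) (πhat : Kernel S A) : Prop :=
  ∃ (V : ℕ → S → ℝ) (π : ℕ → Kernel S A) (Vhat : S → ℝ),
    (∀ s, V 0 s = 0) ∧
    (∀ k, IsGreedy (π k) (pessQ γ Φ lam β D (V k))) ∧
    (∀ k s, V (k + 1) s = ∫ a, pessQ γ Φ lam β D (V k) (s, a) ∂(π k s)) ∧
    (∀ s, Tendsto (fun k => V k s) atTop (𝓝 (Vhat s))) ∧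
    IsGreedy πhat (pessQ γ Φ lam β D Vhat)

end PEVI

/-- `ζ = log (4 d N / ((1 - γ^c) δ))`. -/
def zeta (d N : ℕ) (γ : ℝ) (c : ℕ) (δ : ℝ) : ℝ :=
  Real.log (4 * d * N / ((1 - γ ^ c) * δ))

end HierRL

end

/-! The argument for (1) takes place in an arbitrary linear MDP with discount `γ` and reward bound
`r`; put `H = r / (1 - γ)`. Three facts carry it.

Pessimism. If, for a value function `V`, the ridge prediction differs from the true Bellman backup
of `V` by at most the penalty `β ν`, `ν = √(Φᵀ Λ⁻¹ Φ)`, then `Q̂` lies between the backup and the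
backup minus `2 β ν`. Comparing Bellman inequalities, the limit value is at least the discounted sum
of `r - 2 β ν` under `π*` and at most the return of `π̂`. So the loss is at most twice the
discounted penalty along `π*` (`IsPEVIOutput.suboptimality_le`).

Accuracy. In a linear MDP every backup is linear in the features (`IsLinear.exists_weight`), so the
regression error is `ν` times a bias plus a self-normalised noise sum
(`IsWhitening.abs_ridge_error_le`). The iterates depend on the data, so the noise is bounded
simultaneously for all functions `sup_a (⟨Φ, w⟩ - β ‖B Φ‖)` with bounded parameters: a finite net of
such functions, a grid of directions for the norm, and a Chernoff bound for each pair
(`exists_concentration_event`).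

Coverage. Jensen's inequality and the coverage condition, applied to each row of `B` with `Bᵀ B =
Λ⁻¹`, bound the normalised occupancy average of `ν` by `√(c d / N)` (`discounted_l2_whitening_le`).

The iteration does not truncate its values, so their boundedness has to be proved. If the claimed
bound is at least `2 H`, it is trivial. Otherwise the discounted penalty along `π*` is at most `H`,
and strong induction keeps every iterate between `-3 H` and `H`: pessimism gives the upper end,
comparison with `π*` the lower one.

For (2), the law of `s_c` is linear in the expected feature of the last low-level step, and the
accumulated reward is linear in the discounted sum of expected features. Placing the two in
orthogonal blocks gives the linear structure (`MDP.IsLinear.hyper`). -/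

namespace HierRL

/-! ### Integrals of bounded functions against Markov kernels. -/

section Integrals

variable {X Y W : Type*} [MeasurableSpace X] [MeasurableSpace Y] [MeasurableSpace W]

theorem integrable_of_abs_le (μ : Measure X) [IsFiniteMeasure μ] {f : X → ℝ} (hf : Measurable f)
    {C : ℝ} (hC : ∀ x, |f x| ≤ C) : Integrable f μ :=
  Integrable.of_bound hf.aestronglyMeasurable C (ae_of_all _ hC)

theorem abs_integral_le_of_abs_le (μ : Measure X) [IsProbabilityMeasure μ] {f : X → ℝ}
    {C : ℝ} (hC : ∀ x, |f x| ≤ C) : |∫ x, f x ∂μ| ≤ C := by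
  simpa using norm_integral_le_of_norm_le_const (μ := μ)
    (ae_of_all μ fun x => (Real.norm_eq_abs (f x)).trans_le (hC x))

theorem integral_le_of_le (μ : Measure X) [IsProbabilityMeasure μ] {f : X → ℝ}
    (hi : Integrable f μ) {C : ℝ} (hC : ∀ x, f x ≤ C) : ∫ x, f x ∂μ ≤ C := by
  simpa using integral_mono hi (integrable_const C) hC

theorem le_integral_of_le (μ : Measure X) [IsProbabilityMeasure μ] {f : X → ℝ}
    (hi : Integrable f μ) {C : ℝ} (hC : ∀ x, C ≤ f x) : C ≤ ∫ x, f x ∂μ := by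
  simpa using integral_mono (integrable_const C) hi hC

theorem measurable_integral_kernel (κ : Kernel X Y) [IsSFiniteKernel κ] {f : Y → ℝ}
    (hf : Measurable f) : Measurable fun x => ∫ y, f y ∂(κ x) :=
  (hf.stronglyMeasurable.integral_kernel (κ := κ)).measurable

theorem measurable_integral_kernel_prod (κ : Kernel X Y) [IsSFiniteKernel κ] {f : X × Y → ℝ}
    (hf : Measurable f) : Measurable fun x => ∫ y, f (x, y) ∂(κ x) :=
  (hf.stronglyMeasurable.integral_kernel_prod_right' (κ := κ)).measurable

theorem integral_deterministic_prod (κ : Kernel X Y) [IsSFiniteKernel κ] {g : X → W}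
    (hg : Measurable g) {f : W × Y → ℝ} (hf : Measurable f) (x : X) :
    ∫ p, f p ∂((Kernel.deterministic g hg ×ₖ κ) x) = ∫ y, f (g x, y) ∂(κ x) := by
  rw [Kernel.prod_apply, Kernel.deterministic_apply, Measure.dirac_prod,
    integral_map (by fun_prop) hf.aestronglyMeasurable]

theorem integral_comp_of_abs_le (η : Kernel Y W) [IsMarkovKernel η] (κ : Kernel X Y)
    [IsMarkovKernel κ] {f : W → ℝ} (hf : Measurable f) {C : ℝ} (hC : ∀ w, |f w| ≤ C) (x : X) :
    ∫ w, f w ∂((η ∘ₖ κ) x) = ∫ y, ∫ w, f w ∂(η y) ∂(κ x) :=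
  Kernel.integral_comp (integrable_of_abs_le _ hf hC)

end Integrals

/-! ### Trajectories, discounted sums and Bellman comparison. -/

namespace MDP

variable {S A : Type*} [MeasurableSpace S] [MeasurableSpace A]

instance act_markov (π : Kernel S A) [IsMarkovKernel π] : IsMarkovKernel (act π) := by
  unfold act; infer_instance

instance visit_markov (M : MDP S A) (π : Kernel S A) [IsMarkovKernel π] (t : ℕ) :
    IsMarkovKernel (M.visit π t) := by
  induction t with
  | zero => unfold visit; infer_instance
  | succ t ih =>
    unfold visit
    have := Kernel.IsMarkovKernel.map M.step measurable_snd
    infer_instance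

theorem integral_act (π : Kernel S A) [IsMarkovKernel π] {f : S × A → ℝ} (hf : Measurable f)
    (s : S) : ∫ q, f q ∂(act π s) = ∫ a, f (s, a) ∂(π s) :=
  integral_deterministic_prod π measurable_id hf s

/-- The expected value of `V` at the next state. -/
noncomputable def next (M : MDP S A) (V : S → ℝ) (q : S × A) : ℝ := ∫ p, V p.2 ∂(M.step q)

theorem measurable_next (M : MDP S A) {V : S → ℝ} (hV : Measurable V) : Measurable (M.next V) :=
  measurable_integral_kernel M.step (f := fun p => V p.2) (by fun_prop)

theorem abs_next_le (M : MDP S A) {V : S → ℝ} {C : ℝ} (hC : ∀ s, |V s| ≤ C) (q : S × A) :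
    |M.next V q| ≤ C :=
  abs_integral_le_of_abs_le _ fun p => hC p.2

theorem next_mono (M : MDP S A) {V W : S → ℝ} (hV : Measurable V) (hW : Measurable W)
    {C C' : ℝ} (hC : ∀ s, |V s| ≤ C) (hC' : ∀ s, |W s| ≤ C') (h : ∀ s, V s ≤ W s) (q : S × A) :
    M.next V q ≤ M.next W q :=
  integral_mono (integrable_of_abs_le _ (hV.comp measurable_snd) fun p => hC p.2)
    (integrable_of_abs_le _ (hW.comp measurable_snd) fun p => hC' p.2) fun p => h p.2

theorem next_le (M : MDP S A) {V : S → ℝ} (hV : Measurable V)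
    {C K : ℝ} (hC : ∀ s, |V s| ≤ C) (h : ∀ s, V s ≤ K) (q : S × A) : M.next V q ≤ K :=
  integral_le_of_le _ (integrable_of_abs_le _ (hV.comp measurable_snd) fun p => hC p.2)
    fun p => h p.2

theorem le_next (M : MDP S A) {V : S → ℝ} (hV : Measurable V)
    {C K : ℝ} (hC : ∀ s, |V s| ≤ C) (h : ∀ s, K ≤ V s) (q : S × A) : K ≤ M.next V q :=
  le_integral_of_le _ (integrable_of_abs_le _ (hV.comp measurable_snd) fun p => hC p.2)
    fun p => h p.2

theorem abs_next_sub_next_le (M : MDP S A) {V W : S → ℝ} (hV : Measurable V) (hW : Measurable W)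
    {C C' ε : ℝ} (hC : ∀ s, |V s| ≤ C) (hC' : ∀ s, |W s| ≤ C') (h : ∀ s, |V s - W s| ≤ ε)
    (q : S × A) : |M.next V q - M.next W q| ≤ ε := by
  have h1 : M.next V q - M.next W q = ∫ p, (V p.2 - W p.2) ∂(M.step q) :=
    (integral_sub (integrable_of_abs_le _ (hV.comp measurable_snd) fun p => hC p.2)
      (integrable_of_abs_le _ (hW.comp measurable_snd) fun p => hC' p.2)).symm
  rw [h1]
  exact abs_integral_le_of_abs_le _ fun p => h p.2

theorem measurable_meanReward (M : MDP S A) : Measurable M.meanReward :=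
  measurable_integral_kernel M.step measurable_fst

theorem RewardBounded.abs_meanReward_le {M : MDP S A} {r : ℝ} (h : M.RewardBounded r)
    (q : S × A) : |M.meanReward q| ≤ r := by
  simpa [meanReward] using norm_integral_le_of_norm_le_const (μ := M.step q) (f := Prod.fst) (h q)

/-- The trajectory is extended at its end, so the last transition can be absorbed into the
integrand; this is what turns one step of time into one Bellman backup. -/
theorem integral_visit_succ (M : MDP S A) (π : Kernel S A) [IsMarkovKernel π] {f : S × A → ℝ}
    (hf : Measurable f) {C : ℝ} (hC : ∀ q, |f q| ≤ C) (t : ℕ) (s : S) :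
    ∫ q, f q ∂(M.visit π (t + 1) s)
      = ∫ q, M.next (fun s' => ∫ q', f q' ∂(act π s')) q ∂(M.visit π t s) := by
  have := Kernel.IsMarkovKernel.map M.step measurable_snd
  have hm : Measurable fun s' => ∫ q', f q' ∂(act π s') := measurable_integral_kernel _ hf
  have hb : ∀ s', |∫ q', f q' ∂(act π s')| ≤ C := fun s' => abs_integral_le_of_abs_le _ hC
  conv_lhs => unfold visit
  rw [integral_comp_of_abs_le _ _ hf hC, integral_comp_of_abs_le _ _ hm hb]
  refine integral_congr_ae (ae_of_all _ fun q => ?_)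
  simp only [next]
  rw [Kernel.map_apply _ measurable_snd,
    integral_map measurable_snd.aemeasurable hm.aestronglyMeasurable]

/-- The discounted sum of `f` along the trajectory of `π`; `M.J` is the case of `meanReward`. -/
noncomputable def discounted (M : MDP S A) (γ : ℝ) (π : Kernel S A) (f : S × A → ℝ) (s : S) : ℝ :=
  ∑' t : ℕ, γ ^ t * ∫ q, f q ∂(M.visit π t s)

theorem summable_discounted (M : MDP S A) {γ : ℝ} (h0 : 0 ≤ γ) (h1 : γ < 1) (π : Kernel S A)
    [IsMarkovKernel π] {f : S × A → ℝ} {C : ℝ} (hC : ∀ q, |f q| ≤ C) (s : S) :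
    Summable fun t : ℕ => γ ^ t * ∫ q, f q ∂(M.visit π t s) := by
  refine Summable.of_norm_bounded (E := ℝ)
    ((summable_geometric_of_lt_one h0 h1).mul_right C) fun t => ?_
  rw [norm_mul, Real.norm_of_nonneg (pow_nonneg h0 t)]
  exact mul_le_mul_of_nonneg_left (abs_integral_le_of_abs_le _ hC) (pow_nonneg h0 t)

theorem abs_discounted_le (M : MDP S A) {γ : ℝ} (h0 : 0 ≤ γ) (h1 : γ < 1) (π : Kernel S A)
    [IsMarkovKernel π] {f : S × A → ℝ} {C : ℝ} (hC : ∀ q, |f q| ≤ C) (s : S) :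
    |M.discounted γ π f s| ≤ C / (1 - γ) := by
  have hs := (hasSum_geometric_of_lt_one h0 h1).mul_right C
  rw [inv_mul_eq_div] at hs
  rw [← Real.norm_eq_abs]
  refine tsum_of_norm_bounded hs fun t => ?_
  rw [norm_mul, Real.norm_of_nonneg (pow_nonneg h0 t)]
  exact mul_le_mul_of_nonneg_left (abs_integral_le_of_abs_le _ hC) (pow_nonneg h0 t)

theorem discounted_add_mul (M : MDP S A) {γ : ℝ} (h0 : 0 ≤ γ) (h1 : γ < 1) (π : Kernel S A)
    [IsMarkovKernel π] {f g : S × A → ℝ} (hf : Measurable f) (hg : Measurable g) {C C' : ℝ}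
    (hC : ∀ q, |f q| ≤ C) (hC' : ∀ q, |g q| ≤ C') (a : ℝ) (s : S) :
    M.discounted γ π (fun q => f q + a * g q) s
      = M.discounted γ π f s + a * M.discounted γ π g s := by
  unfold discounted
  rw [← tsum_mul_left, ← Summable.tsum_add (M.summable_discounted h0 h1 π hC s)
    ((M.summable_discounted h0 h1 π hC' s).mul_left a)]
  refine tsum_congr fun t => ?_
  rw [integral_add (integrable_of_abs_le _ hf hC) ((integrable_of_abs_le _ hg hC').const_mul a),
    integral_const_mul]
  ring

/-- Iterates which dominate the Bellman operator of `π` with reward `f` dominate the truncated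
discounted sums of `f`. -/
theorem sum_le_of_bellman_le (M : MDP S A) {γ : ℝ} (h0 : 0 ≤ γ) (π : Kernel S A)
    [IsMarkovKernel π] {f : S × A → ℝ} (hf : Measurable f) {C : ℝ} (hC : ∀ q, |f q| ≤ C)
    {V : ℕ → S → ℝ} (hV : ∀ k, Measurable (V k)) (hB : ∀ k, ∃ B, ∀ s, |V k s| ≤ B) {m : ℝ}
    (hm : ∀ s, -m ≤ V 0 s) (n : ℕ)
    (hstep : ∀ k < n, ∀ s, ∫ q, (f q + γ * M.next (V k) q) ∂(act π s) ≤ V (k + 1) s) (s : S) :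
    ∑ j ∈ Finset.range n, γ ^ j * ∫ q, f q ∂(M.visit π j s) - γ ^ n * m ≤ V n s := by
  choose B hB using hB
  have hUm : ∀ k, Measurable fun q => f q + γ * M.next (V k) q := fun k =>
    hf.add ((M.measurable_next (hV k)).const_mul γ)
  have hUb : ∀ k q, |f q + γ * M.next (V k) q| ≤ C + γ * B k := fun k q => by
    refine (abs_add_le _ _).trans (add_le_add (hC q) ?_)
    rw [abs_mul, abs_of_nonneg h0]
    exact mul_le_mul_of_nonneg_left (M.abs_next_le (hB k) q) h0
  have hsplit : ∀ k t, ∫ q, (f q + γ * M.next (V k) q) ∂(M.visit π t s)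
      = ∫ q, f q ∂(M.visit π t s) + γ * ∫ q, M.next (V k) q ∂(M.visit π t s) := fun k t => by
    rw [integral_add (integrable_of_abs_le _ hf hC)
      ((integrable_of_abs_le _ (M.measurable_next (hV k)) (M.abs_next_le (hB k))).const_mul γ),
      integral_const_mul]
  -- The start time `t` is kept general: unrolling one more backup moves the remaining `k` backups
  -- to time `t + 1`.
  have key : ∀ k ≤ n, ∀ t, ∑ j ∈ Finset.range k, γ ^ j * ∫ q, f q ∂(M.visit π (t + 1 + j) s)
      - γ ^ k * m ≤ ∫ q, M.next (V k) q ∂(M.visit π t s) := by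
    intro k
    induction k with
    | zero =>
      intro _ t
      simpa using le_integral_of_le _
        (integrable_of_abs_le _ (M.measurable_next (hV 0)) (M.abs_next_le (hB 0)))
        (M.le_next (hV 0) (hB 0) hm)
    | succ k ih =>
      intro hk t
      have h2 : ∫ q, (f q + γ * M.next (V k) q) ∂(M.visit π (t + 1) s)
          ≤ ∫ q, M.next (V (k + 1)) q ∂(M.visit π t s) := by
        have hm' := measurable_integral_kernel (act π) (hUm k)
        have hb' := fun s' => abs_integral_le_of_abs_le (act π s') (hUb k)
        rw [M.integral_visit_succ π (hUm k) (hUb k)]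
        exact integral_mono (integrable_of_abs_le _ (M.measurable_next hm') (M.abs_next_le hb'))
          (integrable_of_abs_le _ (M.measurable_next (hV _)) (M.abs_next_le (hB _)))
          (M.next_mono hm' (hV _) hb' (hB _) (hstep k hk))
      rw [hsplit] at h2
      refine le_trans ?_ h2
      have h3 := mul_le_mul_of_nonneg_left (ih (by omega) (t + 1)) h0
      rw [Finset.sum_range_succ', pow_zero, one_mul, add_zero]
      rw [mul_sub, Finset.mul_sum] at h3
      have h4 : ∀ j, γ ^ (j + 1) * ∫ q, f q ∂(M.visit π (t + 1 + (j + 1)) s)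
          = γ * (γ ^ j * ∫ q, f q ∂(M.visit π (t + 1 + 1 + j) s)) := fun j => by
        rw [show t + 1 + (j + 1) = t + 1 + 1 + j by ring]; ring
      simp only [h4]
      have h5 : γ ^ (k + 1) * m = γ * (γ ^ k * m) := by ring
      linarith
  rcases n with _ | k
  · simpa using hm s
  · have h2 : ∫ q, (f q + γ * M.next (V k) q) ∂(M.visit π 0 s) ≤ V (k + 1) s :=
      hstep k (Nat.lt_succ_self k) s
    rw [hsplit] at h2
    refine le_trans ?_ h2
    have h3 := mul_le_mul_of_nonneg_left (key k (Nat.le_succ k) 0) h0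
    rw [Finset.sum_range_succ', pow_zero, one_mul]
    rw [mul_sub, Finset.mul_sum] at h3
    have h4 : ∀ j, γ ^ (j + 1) * ∫ q, f q ∂(M.visit π (j + 1) s)
        = γ * (γ ^ j * ∫ q, f q ∂(M.visit π (0 + 1 + j) s)) := fun j => by
      rw [show 0 + 1 + j = j + 1 by ring]; ring
    simp only [h4]
    have h5 : γ ^ (k + 1) * m = γ * (γ ^ k * m) := by ring
    linarith

/-- A supersolution of the Bellman equation is a constant sequence of dominating iterates; the
boundary term `γ ^ n * B` vanishes as `n → ∞`. -/
theorem discounted_le_of_bellman_le (M : MDP S A) {γ : ℝ} (h0 : 0 ≤ γ) (h1 : γ < 1)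
    (π : Kernel S A) [IsMarkovKernel π] {f : S × A → ℝ} (hf : Measurable f) {C : ℝ}
    (hC : ∀ q, |f q| ≤ C) {V : S → ℝ} (hV : Measurable V) {B : ℝ} (hB : ∀ s, |V s| ≤ B)
    (hstep : ∀ s, ∫ q, (f q + γ * M.next V q) ∂(act π s) ≤ V s) (s : S) :
    M.discounted γ π f s ≤ V s := by
  have h2 := fun n => M.sum_le_of_bellman_le h0 π hf hC (V := fun _ => V) (fun _ => hV)
    (fun _ => ⟨B, hB⟩) (m := B) (fun s => (abs_le.1 (hB s)).1) n (fun _ _ => hstep) s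
  have h3 := (M.summable_discounted h0 h1 π hC s).hasSum.tendsto_sum_nat.sub
    ((tendsto_pow_atTop_nhds_zero_of_lt_one h0 h1).mul_const B)
  rw [zero_mul, sub_zero] at h3
  exact le_of_tendsto' h3 h2

/-- Subsolutions are supersolutions for the reward `-f` after a change of sign. -/
theorem le_discounted_of_le_bellman (M : MDP S A) {γ : ℝ} (h0 : 0 ≤ γ) (h1 : γ < 1)
    (π : Kernel S A) [IsMarkovKernel π] {f : S × A → ℝ} (hf : Measurable f) {C : ℝ}
    (hC : ∀ q, |f q| ≤ C) {V : S → ℝ} (hV : Measurable V) {B : ℝ} (hB : ∀ s, |V s| ≤ B)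
    (hstep : ∀ s, V s ≤ ∫ q, (f q + γ * M.next V q) ∂(act π s)) (s : S) :
    V s ≤ M.discounted γ π f s := by
  have h2 := M.discounted_le_of_bellman_le h0 h1 π hf.neg (C := C) (fun q => by simpa using hC q)
    hV.neg (B := B) (fun q => by simpa using hB q) (fun s => ?_) s
  · simp only [discounted, Pi.neg_apply, integral_neg, mul_neg, tsum_neg] at h2
    exact neg_le_neg_iff.1 h2
  · rw [Pi.neg_apply, ← neg_le_neg_iff, neg_neg]
    refine (hstep s).trans_eq ?_
    rw [← integral_neg]
    refine integral_congr_ae (ae_of_all _ fun q => ?_)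
    simp [next, integral_neg]
    ring

end MDP

/-! ### Ridge regression and the self-normalised norm. -/

section Ridge

open Matrix

variable {ι : Type*} [Fintype ι]

/-- The Euclidean norm of a plain vector. -/
noncomputable def l2 (v : ι → ℝ) : ℝ := ‖(WithLp.toLp 2 v : EuclideanSpace ℝ ι)‖

theorem l2_ofLp (v : EuclideanSpace ℝ ι) : l2 v.ofLp = ‖v‖ := rfl

theorem l2_nonneg (v : ι → ℝ) : 0 ≤ l2 v := norm_nonneg _

theorem l2_add_le (v w : ι → ℝ) : l2 (v + w) ≤ l2 v + l2 w := norm_add_le _ _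

theorem l2_sub_le (v w : ι → ℝ) : l2 (v - w) ≤ l2 v + l2 w := norm_sub_le _ _

theorem l2_smul (c : ℝ) (v : ι → ℝ) : l2 (c • v) = |c| * l2 v := norm_smul c _

theorem abs_l2_sub_l2_le (v w : ι → ℝ) : |l2 v - l2 w| ≤ l2 (v - w) := abs_norm_sub_norm_le _ _

theorem inner_eq_dotProduct (v w : EuclideanSpace ℝ ι) : inner ℝ v w = v.ofLp ⬝ᵥ w.ofLp := by
  rw [EuclideanSpace.inner_eq_star_dotProduct, star_trivial, dotProduct_comm]

theorem abs_dotProduct_le (v w : ι → ℝ) : |v ⬝ᵥ w| ≤ l2 v * l2 w := by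
  have := abs_real_inner_le_norm (WithLp.toLp 2 v : EuclideanSpace ℝ ι) (WithLp.toLp 2 w)
  rwa [inner_eq_dotProduct] at this

theorem dotProduct_self_eq (v : ι → ℝ) : v ⬝ᵥ v = l2 v ^ 2 := by
  have := real_inner_self_eq_norm_sq (WithLp.toLp 2 v : EuclideanSpace ℝ ι)
  rwa [inner_eq_dotProduct] at this

theorem abs_apply_le_l2 (v : ι → ℝ) (i : ι) : |v i| ≤ l2 v :=
  PiLp.norm_apply_le (p := 2) (WithLp.toLp 2 v : EuclideanSpace ℝ ι) i

theorem l2_sum_le {κ : Type*} (s : Finset κ) (v : κ → ι → ℝ) :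
    l2 (∑ k ∈ s, v k) ≤ ∑ k ∈ s, l2 (v k) := by
  classical
  induction s using Finset.induction_on with
  | empty => simp [l2]
  | insert a s ha ih =>
    rw [Finset.sum_insert ha, Finset.sum_insert ha]
    exact (l2_add_le _ _).trans (by linarith)

theorem l2_le_sum_abs (v : ι → ℝ) : l2 v ≤ ∑ i, |v i| := by
  refine abs_le_of_sq_le_sq' ?_ (Finset.sum_nonneg fun i _ => abs_nonneg _) |>.2
  rw [← dotProduct_self_eq, dotProduct, sq, Finset.sum_mul]
  refine Finset.sum_le_sum fun i _ => ?_
  rw [← abs_mul_abs_self]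
  exact mul_le_mul_of_nonneg_left
    (Finset.single_le_sum (f := fun i => |v i|) (fun j _ => abs_nonneg _) (Finset.mem_univ i))
    (abs_nonneg _)

theorem l2_le_card_mul {v : ι → ℝ} {a : ℝ} (h : ∀ i, |v i| ≤ a) :
    l2 v ≤ Fintype.card ι * a := by
  refine (l2_le_sum_abs v).trans ((Finset.sum_le_sum fun i _ => h i).trans_eq ?_)
  simp [Finset.card_univ]

variable [DecidableEq ι] {N : ℕ}

/-- The regularised Gram matrix of the vectors `x τ`. -/
noncomputable def ridgeGram (x : Fin N → ι → ℝ) : Matrix ι ι ℝ :=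
  1 + ∑ τ, vecMulVec (x τ) (x τ)

theorem ridgeGram_mulVec (x : Fin N → ι → ℝ) (v : ι → ℝ) :
    ridgeGram x *ᵥ v = v + ∑ τ, (x τ ⬝ᵥ v) • x τ := by
  rw [ridgeGram, add_mulVec, one_mulVec, sum_mulVec]
  congr 1
  refine Finset.sum_congr rfl fun τ _ => ?_
  rw [vecMulVec_mulVec]
  ext i
  simp [mul_comm]

theorem dotProduct_ridgeGram_mulVec (x : Fin N → ι → ℝ) (v : ι → ℝ) :
    v ⬝ᵥ ridgeGram x *ᵥ v = v ⬝ᵥ v + ∑ τ, (v ⬝ᵥ x τ) ^ 2 := by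
  rw [ridgeGram_mulVec, dotProduct_add, dotProduct_sum]
  congr 1
  refine Finset.sum_congr rfl fun τ _ => ?_
  rw [dotProduct_smul, dotProduct_comm (x τ) v, smul_eq_mul, sq]

theorem l2_sq_le_dotProduct_ridgeGram (x : Fin N → ι → ℝ) (v : ι → ℝ) :
    l2 v ^ 2 ≤ v ⬝ᵥ ridgeGram x *ᵥ v := by
  rw [dotProduct_ridgeGram_mulVec, dotProduct_self_eq]
  exact le_add_of_nonneg_right (Finset.sum_nonneg fun _ _ => sq_nonneg _)

omit [Fintype ι] in
theorem isHermitian_ridgeGram (x : Fin N → ι → ℝ) : (ridgeGram x).IsHermitian := by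
  ext i j
  simp [ridgeGram, Matrix.sum_apply, vecMulVec_apply, one_apply, mul_comm, eq_comm]

theorem posDef_ridgeGram (x : Fin N → ι → ℝ) : (ridgeGram x).PosDef := by
  refine .of_dotProduct_mulVec_pos (isHermitian_ridgeGram x) fun v hv => ?_
  rw [star_trivial]
  refine lt_of_lt_of_le ?_ (l2_sq_le_dotProduct_ridgeGram x v)
  have : 0 < l2 v := norm_pos_iff.2 fun h => hv (by simpa using congrArg WithLp.ofLp h)
  positivity

/-- A matrix `B` with `Bᵀ B = Λ⁻¹`, together with its relations to `Λ`. -/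
structure IsWhitening (x : Fin N → ι → ℝ) (B : Matrix ι ι ℝ) : Prop where
  mul_gram : (ridgeGram x)⁻¹ * ridgeGram x = 1
  gram_mul : ridgeGram x * (ridgeGram x)⁻¹ = 1
  transpose_mul : Bᵀ * B = (ridgeGram x)⁻¹

open scoped MatrixOrder in
-- A positive definite inverse Gram matrix factors as `Bᵀ B`. The factor turns the `Λ⁻¹`-norm of `v`
-- into the Euclidean norm of `B v`, so Cauchy–Schwarz and the triangle inequality apply directly.
theorem exists_isWhitening (x : Fin N → ι → ℝ) : ∃ B, IsWhitening x B := by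
  have hdet : IsUnit (ridgeGram x).det := (isUnit_iff_isUnit_det _).1 (posDef_ridgeGram x).isUnit
  obtain ⟨B, hB⟩ := CStarAlgebra.nonneg_iff_eq_star_mul_self.1
    (posDef_ridgeGram x).inv.posSemidef.nonneg
  refine ⟨B, nonsing_inv_mul _ hdet, mul_nonsing_inv _ hdet, ?_⟩
  rw [hB, star_eq_conjTranspose, conjTranspose_eq_transpose_of_trivial]

namespace IsWhitening

variable {x : Fin N → ι → ℝ} {B : Matrix ι ι ℝ}

theorem dotProduct_inv_mulVec (h : IsWhitening x B) (v w : ι → ℝ) :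
    v ⬝ᵥ (ridgeGram x)⁻¹ *ᵥ w = B *ᵥ v ⬝ᵥ B *ᵥ w := by
  rw [← h.transpose_mul, ← mulVec_mulVec, dotProduct_mulVec, vecMul_transpose]

theorem sqrt_dotProduct_inv_mulVec (h : IsWhitening x B) (v : ι → ℝ) :
    √(v ⬝ᵥ (ridgeGram x)⁻¹ *ᵥ v) = l2 (B *ᵥ v) := by
  rw [h.dotProduct_inv_mulVec, dotProduct_self_eq, Real.sqrt_sq (l2_nonneg _)]

theorem gram_mulVec_inv_mulVec (h : IsWhitening x B) (v : ι → ℝ) :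
    ridgeGram x *ᵥ ((ridgeGram x)⁻¹ *ᵥ v) = v := by
  rw [mulVec_mulVec, h.gram_mul, one_mulVec]

theorem inv_mulVec_gram_mulVec (h : IsWhitening x B) (v : ι → ℝ) :
    (ridgeGram x)⁻¹ *ᵥ (ridgeGram x *ᵥ v) = v := by
  rw [mulVec_mulVec, h.mul_gram, one_mulVec]

/-- Apply `Λ ≥ I` to the vector `Λ⁻¹ v`: its quadratic form under `Λ` is `v ⬝ Λ⁻¹ v = ‖B v‖²`. -/
theorem l2_inv_mulVec_le_l2_mulVec (h : IsWhitening x B) (v : ι → ℝ) :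
    l2 ((ridgeGram x)⁻¹ *ᵥ v) ≤ l2 (B *ᵥ v) := by
  refine abs_le_of_sq_le_sq' ?_ (l2_nonneg _) |>.2
  refine (l2_sq_le_dotProduct_ridgeGram x _).trans_eq ?_
  rw [h.gram_mulVec_inv_mulVec, dotProduct_comm, h.dotProduct_inv_mulVec, dotProduct_self_eq]

theorem l2_mulVec_le (h : IsWhitening x B) (v : ι → ℝ) : l2 (B *ᵥ v) ≤ l2 v := by
  have h1 : l2 (B *ᵥ v) ^ 2 ≤ l2 v * l2 (B *ᵥ v) := by
    rw [← dotProduct_self_eq, ← h.dotProduct_inv_mulVec]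
    exact (le_abs_self _).trans ((abs_dotProduct_le _ _).trans
      (mul_le_mul_of_nonneg_left (h.l2_inv_mulVec_le_l2_mulVec v) (l2_nonneg _)))
  rcases (l2_nonneg (B *ᵥ v)).eq_or_lt with h0 | h0
  · rw [← h0]; exact l2_nonneg v
  · rw [sq] at h1; exact le_of_mul_le_mul_right h1 h0

theorem l2_inv_mulVec_le (h : IsWhitening x B) (v : ι → ℝ) : l2 ((ridgeGram x)⁻¹ *ᵥ v) ≤ l2 v :=
  (h.l2_inv_mulVec_le_l2_mulVec v).trans (h.l2_mulVec_le v)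

/-- Since `B` is a contraction, its matrix lies in a fixed cube whatever the data are, so the
penalties can be covered by a finite net. -/
theorem abs_apply_le (h : IsWhitening x B) (i j : ι) : |B i j| ≤ 1 := by
  have h1 := abs_apply_le_l2 (B *ᵥ Pi.single j 1) i
  rw [mulVec_single_one] at h1
  refine (h1.trans_eq (by rw [mulVec_single_one])).trans ((h.l2_mulVec_le (Pi.single j 1)).trans ?_)
  have h2 := dotProduct_self_eq (Pi.single j (1 : ℝ) : ι → ℝ)
  rw [single_dotProduct, Pi.single_eq_same, mul_one] at h2
  nlinarith [l2_nonneg (Pi.single j (1 : ℝ) : ι → ℝ)]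

/-- From `Bᵀ B Λ = I` follows `B Λ Bᵀ = I`; this is its diagonal. Each row thus spends at most one
unit on the data directions, which is what the coverage bound needs. -/
theorem dotProduct_gram_row (h : IsWhitening x B) (i : ι) : B i ⬝ᵥ ridgeGram x *ᵥ B i = 1 := by
  have hB : B * (ridgeGram x * Bᵀ) = 1 := by
    rw [mul_eq_one_comm, mul_assoc, h.transpose_mul, h.gram_mul]
  have := congrFun (congrFun hB i) i
  rw [one_apply_eq, mul_apply'] at this
  rw [← this]
  rfl

/-- The error of ridge regression is bounded by the self-normalised noise and the bias. -/
theorem abs_ridge_error_le (h : IsWhitening x B) (y : Fin N → ℝ) (w φ : ι → ℝ) :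
    |φ ⬝ᵥ (ridgeGram x)⁻¹ *ᵥ (∑ τ, y τ • x τ) - φ ⬝ᵥ w|
      ≤ l2 (B *ᵥ φ) * (l2 (B *ᵥ ∑ τ, (y τ - x τ ⬝ᵥ w) • x τ) + l2 w) := by
  set s := ∑ τ, (y τ - x τ ⬝ᵥ w) • x τ with hs
  have h1 : ∑ τ, y τ • x τ = (s - w) + ridgeGram x *ᵥ w := by
    rw [ridgeGram_mulVec, hs]
    simp only [sub_smul, Finset.sum_sub_distrib]
    abel
  rw [h1, mulVec_add, h.inv_mulVec_gram_mulVec, dotProduct_add, add_sub_cancel_right,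
    h.dotProduct_inv_mulVec, mulVec_sub]
  refine (abs_dotProduct_le _ _).trans (mul_le_mul_of_nonneg_left ?_ (l2_nonneg _))
  exact (l2_sub_le _ _).trans (by linarith [h.l2_mulVec_le w])

end IsWhitening

/-- The grid of vectors with coordinates `k / m`, `|k| ≤ m`. -/
noncomputable def gridBox (ι : Type*) [Fintype ι] [DecidableEq ι] (m : ℕ) : Finset (ι → ℤ) :=
  Fintype.piFinset fun _ => Finset.Icc (-(m : ℤ)) m

theorem card_gridBox (m : ℕ) : (gridBox ι m).card = (2 * m + 1) ^ Fintype.card ι := by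
  have h : (Finset.Icc (-(m : ℤ)) m).card = 2 * m + 1 := by rw [Int.card_Icc]; omega
  simp [gridBox, h, -Int.card_Icc]

theorem mem_gridBox {m : ℕ} {k : ι → ℤ} : k ∈ gridBox ι m ↔ ∀ i, |k i| ≤ m := by
  simp [gridBox, abs_le]

theorem exists_gridBox_near {m : ℕ} (hm : 0 < m) {y : ι → ℝ} (hy : ∀ i, |y i| ≤ 1) :
    ∃ k ∈ gridBox ι m, ∀ i, |y i - k i / m| ≤ 1 / (2 * m) := by
  have hm' : (0 : ℝ) < m := by exact_mod_cast hm
  refine ⟨fun i => round (y i * m), mem_gridBox.2 fun i => ?_, fun i => ?_⟩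
  · have h1 := abs_le.1 (hy i)
    have h2 := abs_le.1 (abs_sub_round (y i * m))
    have h3 : |((round (y i * m) : ℤ) : ℝ)| < m + 1 := by
      rw [abs_lt]; constructor <;> nlinarith
    have h4 : |round (y i * m)| < (m : ℤ) + 1 := by exact_mod_cast h3
    omega
  · have h2 := abs_sub_round (y i * m)
    have h3 : y i - (round (y i * m) : ℤ) / m = (y i * m - (round (y i * m) : ℤ)) / m := by
      field_simp
    rw [h3, abs_div, abs_of_pos hm', div_le_div_iff₀ hm' (by positivity)]
    nlinarith

/-- The self-normalised norm of `∑ n τ • x τ` is controlled by finitely many directions. -/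
theorem IsWhitening.l2_mulVec_sum_le_of_grid {x : Fin N → ι → ℝ} {B : Matrix ι ι ℝ}
    (h : IsWhitening x B) (hx : ∀ τ, l2 (x τ) ≤ 1) {n : Fin N → ℝ} {K Z : ℝ}
    (hK : ∀ τ, |n τ| ≤ K) (hK0 : 0 ≤ K) (hZ : 0 ≤ Z) {m : ℕ} (hd : 0 < Fintype.card ι)
    (hm : m = Fintype.card ι * (N + 1))
    (hgrid : ∀ k ∈ gridBox ι m, l2 (fun i => (k i : ℝ) / m) ≤ 2 →
      ∑ τ, ((fun i => (k i : ℝ) / m) ⬝ᵥ x τ) ^ 2 ≤ 3 →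
      (fun i => (k i : ℝ) / m) ⬝ᵥ (∑ τ, n τ • x τ) ≤ Z) :
    l2 (B *ᵥ ∑ τ, n τ • x τ) ≤ Z + K / 2 := by
  set s := ∑ τ, n τ • x τ with hs
  rcases (l2_nonneg (B *ᵥ s)).eq_or_lt with h0 | h0
  · rw [← h0]; positivity
  set u := l2 (B *ᵥ s) with hu
  -- The direction dual to `s`: it has unit `Λ`-norm and its pairing with `s` is exactly the norm to
  -- be bounded. It depends on the data, hence the grid.
  set y : ι → ℝ := u⁻¹ • ((ridgeGram x)⁻¹ *ᵥ s) with hy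
  have hys : y ⬝ᵥ s = u := by
    rw [hy, smul_dotProduct, dotProduct_comm, h.dotProduct_inv_mulVec, dotProduct_self_eq, ← hu,
      smul_eq_mul]
    field_simp
  have hyy : y ⬝ᵥ ridgeGram x *ᵥ y = 1 := by
    rw [hy, mulVec_smul, h.gram_mulVec_inv_mulVec, ← hy, dotProduct_smul, hys, smul_eq_mul]
    field_simp
  have hy1 : l2 y ≤ 1 := by
    have := l2_sq_le_dotProduct_ridgeGram x y
    rw [hyy] at this
    nlinarith [l2_nonneg y]
  have hyx : ∑ τ, (y ⬝ᵥ x τ) ^ 2 ≤ 1 := by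
    rw [dotProduct_ridgeGram_mulVec, dotProduct_self_eq] at hyy
    nlinarith [l2_nonneg y]
  have hd' : (0 : ℝ) < Fintype.card ι := by exact_mod_cast hd
  have hm0 : 0 < m := hm ▸ by positivity
  have hm' : (m : ℝ) = Fintype.card ι * (N + 1) := by rw [hm]; push_cast; rfl
  obtain ⟨k, hk, hky⟩ := exists_gridBox_near hm0 fun i => (abs_apply_le_l2 y i).trans hy1
  set z : ι → ℝ := fun i => (k i : ℝ) / m with hz
  -- With `m = d (N + 1)` the rounding error is small enough that even `N` copies of it sum to at
  -- most `1 / 2`.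
  have he : l2 (y - z) ≤ 1 / (2 * (N + 1)) := by
    refine (l2_le_card_mul (v := y - z) hky).trans_eq ?_
    rw [hm']
    field_simp
  have hN : (0 : ℝ) ≤ N := Nat.cast_nonneg N
  have he2 : l2 (y - z) ≤ 1 / 2 := he.trans (by
    rw [div_le_div_iff₀ (by positivity) (by positivity)]; linarith)
  have hexτ : ∀ τ, |(y - z) ⬝ᵥ x τ| ≤ l2 (y - z) := fun τ =>
    (abs_dotProduct_le _ _).trans (mul_le_of_le_one_right (l2_nonneg _) (hx τ))
  have hNe : N * l2 (y - z) ≤ 1 / 2 := by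
    refine (mul_le_mul_of_nonneg_left he hN).trans ?_
    rw [mul_one_div, div_le_div_iff₀ (by positivity) (by positivity)]
    linarith
  have hz2 : l2 z ≤ 2 := by
    have : z = y - (y - z) := by abel
    rw [this]
    exact (l2_sub_le _ _).trans (by linarith)
  have hz3 : ∑ τ, (z ⬝ᵥ x τ) ^ 2 ≤ 3 := by
    -- From `(a - e)² ≤ 2 a² + 2 e²`; the last term is at most `l2 (y - z)`, because `|e| ≤ l2 (y -
    -- z) ≤ 1 / 2`.
    have h1 : ∀ τ, (z ⬝ᵥ x τ) ^ 2 ≤ 2 * (y ⬝ᵥ x τ) ^ 2 + l2 (y - z) := fun τ => by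
      have h2 : z ⬝ᵥ x τ = y ⬝ᵥ x τ - (y - z) ⬝ᵥ x τ := by rw [sub_dotProduct]; ring
      have h3 := sq_le_sq' (abs_le.1 (hexτ τ)).1 (abs_le.1 (hexτ τ)).2
      rw [h2]
      nlinarith [sq_nonneg (y ⬝ᵥ x τ + (y - z) ⬝ᵥ x τ), l2_nonneg (y - z)]
    refine (Finset.sum_le_sum fun τ _ => h1 τ).trans ?_
    rw [Finset.sum_add_distrib, ← Finset.mul_sum]
    simp only [Finset.sum_const, Finset.card_univ, Fintype.card_fin, nsmul_eq_mul]
    linarith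
  have h4 := hgrid k hk hz2 hz3
  have h5 : |(y - z) ⬝ᵥ s| ≤ K / 2 := by
    have h6 : l2 s ≤ N * K := by
      refine (l2_sum_le _ _).trans ((Finset.sum_le_sum (g := fun _ => K) fun τ _ => ?_).trans_eq ?_)
      · rw [l2_smul]
        exact (mul_le_of_le_one_right (abs_nonneg _) (hx τ)).trans (hK τ)
      · simp
    refine (abs_dotProduct_le _ _).trans ((mul_le_mul_of_nonneg_left h6 (l2_nonneg _)).trans ?_)
    nlinarith
  rw [sub_dotProduct, hys] at h5
  linarith [(abs_le.1 h5).2]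

end Ridge

/-! ### Exponential concentration for adaptively collected data. -/

section Concentration

variable {S A Ω : Type*} [MeasurableSpace S] [MeasurableSpace A] [mΩ : MeasurableSpace Ω] {N : ℕ}
  {M : MDP S A} {P : Measure Ω} {D : Fin N → Ω → Transition S A}

namespace IsDatasetOf

theorem past_le (h : IsDatasetOf M P D) (τ : Fin N) : past D τ ≤ mΩ :=
  sup_le (iSup₂_le fun j _ => (h.measurable j).comap_le)
    ((measurable_fst.comp (h.measurable τ)).comap_le)

/-- The conditional law is given on events only. Restricted to a past event, the joint law of pair
and outcome agrees with the composition product on rectangles, hence everywhere, which extends the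
law to nonnegative functions. -/
theorem setLIntegral_eq [IsFiniteMeasure P] (h : IsDatasetOf M P D) (τ : Fin N) {E : Set Ω}
    (hE : MeasurableSet[past D τ] E) {f : Transition S A → ℝ≥0∞} (hf : Measurable f) :
    ∫⁻ ω in E, f (D τ ω) ∂P = ∫⁻ ω in E, ∫⁻ p, f ((D τ ω).1, p) ∂(M.step (D τ ω).1) ∂P := by
  have hEm : MeasurableSet E := h.past_le τ _ hE
  have hD := h.measurable τ
  have hD1 : Measurable fun ω => (D τ ω).1 := measurable_fst.comp hD
  have key : (P.restrict E).map (D τ)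
      = ((P.restrict E).map fun ω => (D τ ω).1) ⊗ₘ M.step := by
    refine Measure.ext_prod fun {a b} ha hb => ?_
    have hpre : MeasurableSet[past D τ] ((fun ω => (D τ ω).1) ⁻¹' a) :=
      (le_sup_right : _ ≤ past D τ) _ ⟨a, ha, rfl⟩
    rw [Measure.map_apply hD (ha.prod hb), Measure.compProd_apply_prod ha hb,
      setLIntegral_map ha (M.step.measurable_coe hb) hD1,
      Measure.restrict_restrict (hD1 ha), Measure.restrict_apply (hD (ha.prod hb)),
      ← h.law τ _ b (hpre.inter hE) hb]
    congr 1
    ext ω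
    simp only [Set.mem_inter_iff, Set.mem_preimage, Set.mem_prod, Set.mem_ofPred_eq]
    tauto
  rw [← lintegral_map hf hD, key, Measure.lintegral_compProd hf,
    lintegral_map (hf.lintegral_kernel_prod_right' (κ := M.step)) hD1]

/-- On the past σ-algebra, the measure with density `f (D τ)` is dominated by `P`, because the
conditional mean of `f` is at most `1`. A factor that is measurable with respect to the past may
then be integrated against either. -/
theorem lintegral_mul_le [IsFiniteMeasure P] (h : IsDatasetOf M P D) (τ : Fin N) {g : Ω → ℝ≥0∞}
    (hg : Measurable[past D τ] g) {f : Transition S A → ℝ≥0∞} (hf : Measurable f)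
    (h1 : ∀ q, ∫⁻ p, f (q, p) ∂(M.step q) ≤ 1) :
    ∫⁻ ω, g ω * f (D τ ω) ∂P ≤ ∫⁻ ω, g ω ∂P := by
  have hle := h.past_le τ
  have hgm : Measurable g := hg.mono hle le_rfl
  have hF : Measurable fun ω => f (D τ ω) := hf.comp (h.measurable τ)
  have h2 : (P.withDensity fun ω => f (D τ ω)).trim hle ≤ P.trim hle := by
    refine Measure.le_intro fun E hE _ => ?_
    rw [trim_measurableSet_eq hle hE, trim_measurableSet_eq hle hE,
      withDensity_apply _ (hle _ hE), h.setLIntegral_eq τ hE hf]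
    exact (lintegral_mono fun ω => h1 _).trans_eq (by simp)
  calc ∫⁻ ω, g ω * f (D τ ω) ∂P = ∫⁻ ω, g ω ∂(P.withDensity fun ω => f (D τ ω)) := by
        rw [lintegral_withDensity_eq_lintegral_mul _ hF hgm]
        exact lintegral_congr fun ω => mul_comm _ _
    _ = ∫⁻ ω, g ω ∂((P.withDensity fun ω => f (D τ ω)).trim hle) := (lintegral_trim hle hg).symm
    _ ≤ ∫⁻ ω, g ω ∂(P.trim hle) := lintegral_mono' h2 le_rfl
    _ = ∫⁻ ω, g ω ∂P := lintegral_trim hle hg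

/-- The supermartingale bound for products over the transitions. -/
theorem lintegral_prod_le_one [IsProbabilityMeasure P] (h : IsDatasetOf M P D)
    {f : Transition S A → ℝ≥0∞} (hf : Measurable f)
    (h1 : ∀ q, ∫⁻ p, f (q, p) ∂(M.step q) ≤ 1) : ∫⁻ ω, ∏ τ, f (D τ ω) ∂P ≤ 1 := by
  -- Peel off the latest factor: the product of the earlier ones is known before its outcome.
  have key : ∀ n ≤ N, ∫⁻ ω, ∏ τ : Fin N with τ.val < n, f (D τ ω) ∂P ≤ 1 := by
    intro n
    induction n with
    | zero => intro _; simp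
    | succ n ih =>
      intro hn
      have hs : (Finset.univ.filter fun τ : Fin N => τ.val < n + 1)
          = insert ⟨n, hn⟩ (Finset.univ.filter fun τ : Fin N => τ.val < n) := by
        ext τ
        simp [Fin.ext_iff]
        omega
      simp only [hs]
      simp only [Finset.prod_insert (show (⟨n, hn⟩ : Fin N) ∉
        Finset.univ.filter fun τ : Fin N => τ.val < n by simp)]
      simp only [mul_comm (f (D ⟨n, hn⟩ _))]
      refine (h.lintegral_mul_le ⟨n, hn⟩ ?_ hf h1).trans (ih (by omega))
      refine Finset.measurable_prod _ fun τ hτ => ?_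
      have hlt : τ < ⟨n, hn⟩ := by simpa [Fin.lt_def] using hτ
      refine hf.comp ?_
      refine Measurable.mono (comap_measurable (D τ)) ?_ le_rfl
      exact (le_iSup₂_of_le (f := fun (j : Fin N) (_ : j < ⟨n, hn⟩) =>
        MeasurableSpace.comap (D j) inferInstance) τ hlt le_rfl).trans le_sup_left
  have := key N le_rfl
  simpa using this

theorem ae_of_ae_step [IsFiniteMeasure P] (h : IsDatasetOf M P D) {p : ℝ × S → Prop}
    (hp : MeasurableSet {x | p x}) (hM : ∀ q, ∀ᵐ x ∂(M.step q), p x) (τ : Fin N) :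
    ∀ᵐ ω ∂P, p (D τ ω).2 := by
  have := h.law τ Set.univ {x | p x}ᶜ MeasurableSet.univ hp.compl
  rw [Set.univ_inter] at this
  rw [ae_iff]
  refine this.trans ?_
  simp only [Measure.restrict_univ]
  rw [lintegral_eq_zero_iff (by
    exact (M.step.measurable_coe hp.compl).comp (measurable_fst.comp (h.measurable τ)))]
  exact ae_of_all _ fun ω => ae_iff.1 (hM _)

/-- A Chernoff bound for sums of centred, bounded functions of the transitions, weighted by
predictable factors `a`, with the weights' sum of squares on the other side. -/
theorem measure_chernoff_le [IsProbabilityMeasure P] (h : IsDatasetOf M P D)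
    {Y : ℝ × S → ℝ} (hY : Measurable Y) {K : ℝ} (hK : 0 ≤ K)
    (hYK : ∀ q, ∀ᵐ p ∂(M.step q), |Y p| ≤ K) {a : S × A → ℝ} (ha : Measurable a) (l : ℝ) :
    P {ω | l ≤ ∑ τ, (a (D τ ω).1 * (Y (D τ ω).2 - ∫ p, Y p ∂(M.step (D τ ω).1))
      - a (D τ ω).1 ^ 2 * K ^ 2 / 2)} ≤ ENNReal.ofReal (Real.exp (-l)) := by
  set g : Transition S A → ℝ := fun x =>
    a x.1 * (Y x.2 - ∫ p, Y p ∂(M.step x.1)) - a x.1 ^ 2 * K ^ 2 / 2 with hg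
  have hgm : Measurable g := by
    have hm : Measurable fun x : Transition S A => ∫ p, Y p ∂(M.step x.1) :=
      (measurable_integral_kernel M.step hY).comp measurable_fst
    have ha' : Measurable fun x : Transition S A => a x.1 := ha.comp measurable_fst
    exact (ha'.mul ((hY.comp measurable_snd).sub hm)).sub
      (((ha'.pow_const 2).mul_const _).div_const _)
  have hfm : Measurable fun x => ENNReal.ofReal (Real.exp (g x)) := by fun_prop
  have h1 : ∀ q, ∫⁻ p, ENNReal.ofReal (Real.exp (g (q, p))) ∂(M.step q) ≤ 1 := by
    intro q
    -- Hoeffding's lemma: an interval of length `2 K` has variance proxy `K ^ 2`. Subtracting `a² K²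
    -- / 2` in the exponent makes the conditional exponential moment at most `1`.
    have hsub := hasSubgaussianMGF_of_mem_Icc (μ := M.step q) (X := Y) (a := -K) (b := K)
      hY.aemeasurable (by filter_upwards [hYK q] with p hp using abs_le.1 hp)
    have hi := hsub.integrable_exp_mul (a q)
    have hle := hsub.mgf_le (a q)
    have hnn : (((‖K - -K‖₊ / 2) ^ 2 : ℝ≥0) : ℝ) = K ^ 2 := by
      push_cast
      rw [Real.norm_of_nonneg (by linarith)]
      ring
    rw [hnn, mgf] at hle
    have he : ∀ p, Real.exp (g (q, p)) = Real.exp (a q * (Y p - ∫ p, Y p ∂(M.step q)))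
        * Real.exp (-(a q ^ 2 * K ^ 2 / 2)) := fun p => by
      rw [← Real.exp_add, hg]
      congr 1
    simp only [he]
    rw [← ofReal_integral_eq_lintegral_ofReal (hi.mul_const _)
      (ae_of_all _ fun p => by positivity), ← ENNReal.ofReal_one]
    refine ENNReal.ofReal_le_ofReal ?_
    rw [integral_mul_const]
    refine (mul_le_mul_of_nonneg_right hle (Real.exp_nonneg _)).trans_eq ?_
    rw [← Real.exp_add, ← Real.exp_zero]
    congr 1
    ring
  have h2 := h.lintegral_prod_le_one hfm h1
  have h3 : ∀ ω, ∏ τ, ENNReal.ofReal (Real.exp (g (D τ ω)))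
      = ENNReal.ofReal (Real.exp (∑ τ, g (D τ ω))) := fun ω => by
    rw [Real.exp_sum, ENNReal.ofReal_prod_of_nonneg fun _ _ => Real.exp_nonneg _]
  simp only [h3] at h2
  have hsm : Measurable fun ω => ENNReal.ofReal (Real.exp (∑ τ, g (D τ ω))) := by
    have : ∀ τ, Measurable fun ω => g (D τ ω) := fun τ => hgm.comp (h.measurable τ)
    exact (Real.measurable_exp.comp
      (Finset.measurable_sum _ fun τ _ => this τ)).ennreal_ofReal
  -- Markov's inequality for the exponential.
  have h4 := mul_meas_ge_le_lintegral (μ := P) hsm (ENNReal.ofReal (Real.exp l))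
  have h5 : {ω | l ≤ ∑ τ, g (D τ ω)} = {ω | ENNReal.ofReal (Real.exp l)
      ≤ ENNReal.ofReal (Real.exp (∑ τ, g (D τ ω)))} := by
    ext ω
    simp only [Set.mem_ofPred_eq]
    rw [ENNReal.ofReal_le_ofReal_iff (Real.exp_nonneg _), Real.exp_le_exp]
  change P {ω | l ≤ ∑ τ, g (D τ ω)} ≤ _
  rw [h5, Real.exp_neg, ENNReal.ofReal_inv_of_pos (Real.exp_pos l)]
  rw [ENNReal.le_inv_iff_mul_le, mul_comm]
  exact h4.trans h2

end IsDatasetOf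

end Concentration

/-! ### Linearity of Bellman backups in the features. -/

namespace MDP

variable {S A ι : Type*} [MeasurableSpace S] [MeasurableSpace A] [Fintype ι]
  {M : MDP S A} {Φ : S × A → EuclideanSpace ℝ ι}

/-- The layer-cake count behind the step-function approximation below. -/
theorem sum_indicator_lt_eq_ceil {x : ℝ} {n : ℕ} (h : x ≤ n) :
    ∑ j ∈ Finset.range n, (if (j : ℝ) < x then (1 : ℝ) else 0) = ⌈x⌉₊ := by
  rw [Finset.sum_boole]
  congr 1
  have : (Finset.range n).filter (fun j : ℕ => (j : ℝ) < x) = Finset.range ⌈x⌉₊ := by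
    ext j
    simp only [Finset.mem_filter, Finset.mem_range, ← Nat.lt_ceil]
    exact ⟨fun h => h.2, fun hj => ⟨hj.trans_le (Nat.ceil_le.2 h), hj⟩⟩
  rw [this, Finset.card_range]

/-- If the transition law is linear in the features, so is the expectation of a function with
values in `[0, 1]`, with a weight vector of the same size. -/
theorem exists_weight_of_mem_Icc {R : ℝ} {μ : VectorMeasure S (EuclideanSpace ℝ ι)}
    (hR : ∀ B, MeasurableSet B → ‖μ B‖ ≤ R)
    (hμ : ∀ q B, MeasurableSet B → (M.step q).real (Prod.snd ⁻¹' B) = inner ℝ (Φ q) (μ B))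
    {U : S → ℝ} (hU : Measurable U) (h0 : ∀ s, 0 ≤ U s) (h1 : ∀ s, U s ≤ 1) :
    ∃ w : EuclideanSpace ℝ ι, ‖w‖ ≤ R ∧ ∀ q, M.next U q = inner ℝ (Φ q) w := by
  have happrox : ∀ n : ℕ, ∃ w : EuclideanSpace ℝ ι, w ∈ Metric.closedBall 0 R ∧
      ∀ q, |M.next U q - inner ℝ (Φ q) w| ≤ 1 / ((n : ℝ) + 1) := by
    intro n
    have hn : (0 : ℝ) < (n : ℝ) + 1 := by positivity
    -- Averaging the indicators of `n + 1` superlevel sets approximates `U` uniformly. The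
    -- corresponding weight is an average of vectors `μ (T j)`, so it stays in the ball of radius
    -- `R`, with no loss in the constant.
    set T : ℕ → Set S := fun j => {s | (j : ℝ) < (n + 1) * U s} with hT
    have hTm : ∀ j, MeasurableSet (T j) := fun j =>
      measurableSet_lt measurable_const (hU.const_mul _)
    set W : S → ℝ := fun s => ((n : ℝ) + 1)⁻¹ * ∑ j ∈ Finset.range (n + 1),
      (T j).indicator (fun _ => (1 : ℝ)) s with hW
    have hWm : Measurable W :=
      (Finset.measurable_sum _ fun j _ => measurable_const.indicator (hTm j)).const_mul _
    have hWU : ∀ s, |U s - W s| ≤ 1 / ((n : ℝ) + 1) := by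
      intro s
      have hx0 : 0 ≤ ((n : ℝ) + 1) * U s := mul_nonneg hn.le (h0 s)
      have hxn : ((n : ℝ) + 1) * U s ≤ (n + 1 : ℕ) := by
        push_cast; exact mul_le_of_le_one_right hn.le (h1 s)
      have h3 : W s = ((n : ℝ) + 1)⁻¹ * ⌈((n : ℝ) + 1) * U s⌉₊ := by
        rw [hW, ← sum_indicator_lt_eq_ceil hxn]
        simp [hT, Set.indicator_apply]
      have h4 := Nat.le_ceil (((n : ℝ) + 1) * U s)
      have h5 := Nat.ceil_lt_add_one hx0
      have h6 : U s - W s = (((n : ℝ) + 1) * U s - ⌈((n : ℝ) + 1) * U s⌉₊) / (n + 1) := by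
        rw [h3]; field_simp
      rw [h6, abs_div, abs_of_pos hn]
      refine div_le_div_of_nonneg_right ?_ hn.le
      rw [abs_le]; constructor <;> linarith
    have hUb : ∀ s, |U s| ≤ 1 := fun s => abs_le.2 ⟨by linarith [h0 s], h1 s⟩
    have hWb : ∀ s, |W s| ≤ 1 + 1 / ((n : ℝ) + 1) := fun s => by
      have : W s = U s - (U s - W s) := by ring
      rw [this]
      exact (abs_sub _ _).trans (add_le_add (hUb s) (hWU s))
    refine ⟨((n : ℝ) + 1)⁻¹ • ∑ j ∈ Finset.range (n + 1), μ (T j), ?_, fun q => ?_⟩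
    · rw [mem_closedBall_zero_iff, norm_smul, norm_inv, Real.norm_of_nonneg hn.le,
        inv_mul_le_iff₀ hn]
      refine (norm_sum_le_of_le _ fun j _ => hR _ (hTm j)).trans_eq ?_
      simp
    · have h7 : M.next W q = inner ℝ (Φ q)
          (((n : ℝ) + 1)⁻¹ • ∑ j ∈ Finset.range (n + 1), μ (T j)) := by
        rw [inner_smul_right, inner_sum, next, hW]
        rw [integral_const_mul, integral_finsetSum]
        · congr 1
          refine Finset.sum_congr rfl fun j _ => ?_
          rw [← hμ q _ (hTm j), ← integral_indicator_one (measurable_snd (hTm j))]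
          rfl
        · intro j _
          exact (integrable_const (1 : ℝ)).indicator (measurable_snd (hTm j))
      rw [← h7]
      exact M.abs_next_sub_next_le hU hWm hUb hWb hWU q
  choose w hwR hw using happrox
  -- Compactness of the ball provides a single weight valid for all `q` at once.
  obtain ⟨v, hv, φ, hφ, hlim⟩ := (isCompact_closedBall (0 : EuclideanSpace ℝ ι) R).tendsto_subseq
    hwR
  refine ⟨v, mem_closedBall_zero_iff.1 hv, fun q => ?_⟩
  have h2 : Tendsto (fun n => inner ℝ (Φ q) (w (φ n))) atTop (𝓝 (inner ℝ (Φ q) v)) :=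
    tendsto_const_nhds.inner hlim
  have h3 : Tendsto (fun n => inner ℝ (Φ q) (w (φ n))) atTop (𝓝 (M.next U q)) := by
    refine Tendsto.comp (g := fun n => inner ℝ (Φ q) (w n)) ?_ hφ.tendsto_atTop
    refine tendsto_iff_dist_tendsto_zero.2 (squeeze_zero (fun _ => dist_nonneg) (fun n => ?_)
      tendsto_one_div_add_atTop_nhds_zero_nat)
    rw [dist_comm, Real.dist_eq]
    exact hw n q
  exact tendsto_nhds_unique h3 h2

/-- In a linear MDP, every Bellman backup of a bounded function is linear in the features. -/
theorem IsLinear.exists_weight {r : ℝ} (h : M.IsLinear Φ r) {γ : ℝ} (h0 : 0 ≤ γ) {V : S → ℝ}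
    (hV : Measurable V) {K : ℝ} (hK : 0 ≤ K) (hVK : ∀ s, |V s| ≤ K) :
    ∃ w : EuclideanSpace ℝ ι, ‖w‖ ≤ √(Fintype.card ι) * (r + γ * (3 * K)) ∧
      ∀ q, M.meanReward q + γ * M.next V q = inner ℝ (Φ q) w := by
  obtain ⟨-, -, ⟨μ, hR, hμ⟩, θ, hθ, hr⟩ := h
  -- Rescaling to `[0, 1]`; undoing it contributes `2 K` from the slope and `K` from the shift,
  -- whence `3 K`. For `K = 0` both sides of the inversion formula vanish.
  set U : S → ℝ := fun s => (V s + K) / (2 * K) with hU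
  have hUm : Measurable U := (hV.add_const K).div_const _
  have hU0 : ∀ s, 0 ≤ U s := fun s => div_nonneg (by linarith [abs_le.1 (hVK s)]) (by positivity)
  have hU1 : ∀ s, U s ≤ 1 := fun s =>
    div_le_one_of_le₀ (by linarith [(abs_le.1 (hVK s)).2]) (by positivity)
  have hVU : ∀ s, V s = 2 * K * U s - K := fun s => by
    rcases hK.eq_or_lt with hK0 | hK0
    · have := abs_nonpos_iff.1 ((hVK s).trans_eq hK0.symm)
      rw [this, ← hK0]; simp
    · rw [hU]; field_simp; ring
  obtain ⟨u, hu, hux⟩ := exists_weight_of_mem_Icc hR hμ hUm hU0 hU1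
  refine ⟨θ + γ • ((2 * K) • u - K • μ Set.univ), ?_, fun q => ?_⟩
  · have h1 : ‖(2 * K) • u - K • μ Set.univ‖ ≤ √(Fintype.card ι) * (3 * K) := by
      refine (norm_sub_le _ _).trans ?_
      rw [norm_smul, norm_smul, Real.norm_of_nonneg hK, Real.norm_of_nonneg (by positivity)]
      have := mul_le_mul_of_nonneg_left (hR _ MeasurableSet.univ) hK
      have := mul_le_mul_of_nonneg_left hu (by positivity : 0 ≤ 2 * K)
      linarith
    refine (norm_add_le _ _).trans ?_
    rw [norm_smul, Real.norm_of_nonneg h0]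
    have := mul_le_mul_of_nonneg_left h1 h0
    linarith
  · have h2 : M.next V q = 2 * K * M.next U q - K := by
      simp only [next, hVU]
      rw [integral_sub _ (integrable_const K), integral_const_mul]
      · simp
      · refine Integrable.const_mul (integrable_of_abs_le _ (hUm.comp measurable_snd)
          (C := 1) fun p => ?_) _
        exact abs_le.2 ⟨(by norm_num : (-1 : ℝ) ≤ 0).trans (hU0 p.2), hU1 p.2⟩
    have h3 := hμ q _ MeasurableSet.univ
    rw [Set.preimage_univ, probReal_univ] at h3
    rw [h2, hux, hr, inner_add_right, inner_smul_right, inner_sub_right, inner_smul_right,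
      inner_smul_right, ← h3]
    ring

end MDP

/-! ### A finite net for the possible value functions. -/

section ValueClass

open Matrix

variable {S A ι : Type*} [MeasurableSpace S] [Fintype ι]

/-- `V` is the maximum over the actions of `⟨Φ, w⟩ - β ‖B Φ‖`, and all data are bounded. -/
structure IsPenalizedMax (Φ : S × A → EuclideanSpace ℝ ι) (β K W : ℝ) (w : ι → ℝ)
    (B : Matrix ι ι ℝ) (V : S → ℝ) : Prop where
  measurable : Measurable V
  abs_le : ∀ s, |V s| ≤ K
  weight_le : ∀ i, |w i| ≤ W
  entry_le : ∀ i j, |B i j| ≤ 1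
  isLUB : ∀ s, IsLUB (Set.range fun a => (Φ (s, a)).ofLp ⬝ᵥ w - β * l2 (B *ᵥ (Φ (s, a)).ofLp)) (V s)

theorem l2_mulVec_le_card_sq {B : Matrix ι ι ℝ} {v : ι → ℝ} (hv : l2 v ≤ 1) {b : ℝ}
    (hb : ∀ i j, |B i j| ≤ b) : l2 (B *ᵥ v) ≤ Fintype.card ι * (Fintype.card ι * b) := by
  refine l2_le_card_mul fun i => ?_
  refine (Finset.abs_sum_le_sum_abs _ _).trans ?_
  refine (Finset.sum_le_sum (g := fun _ => b) fun j _ => ?_).trans_eq (by simp [Finset.card_univ])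
  rw [abs_mul]
  exact (mul_le_of_le_one_right (abs_nonneg _) ((abs_apply_le_l2 v j).trans hv)).trans (hb i j)

/-- A supremum moves by no more than the functions under it, and these are Lipschitz in the
parameters uniformly over the unit ball of features. -/
theorem IsPenalizedMax.abs_sub_le {Φ : S × A → EuclideanSpace ℝ ι} (hΦ : ∀ q, ‖Φ q‖ ≤ 1)
    {β K W : ℝ} (hβ : 0 ≤ β) {w w' : ι → ℝ} {B B' : Matrix ι ι ℝ} {V V' : S → ℝ}
    (h : IsPenalizedMax Φ β K W w B V) (h' : IsPenalizedMax Φ β K W w' B' V') {a b : ℝ}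
    (hw : ∀ i, |w i - w' i| ≤ a) (hB : ∀ i j, |B i j - B' i j| ≤ b) (s : S) :
    |V s - V' s| ≤ Fintype.card ι * a + β * (Fintype.card ι * (Fintype.card ι * b)) := by
  have key : ∀ x, |((Φ (s, x)).ofLp ⬝ᵥ w - β * l2 (B *ᵥ (Φ (s, x)).ofLp))
      - ((Φ (s, x)).ofLp ⬝ᵥ w' - β * l2 (B' *ᵥ (Φ (s, x)).ofLp))|
      ≤ Fintype.card ι * a + β * (Fintype.card ι * (Fintype.card ι * b)) := fun x => by
    have hx : l2 (Φ (s, x)).ofLp ≤ 1 := hΦ _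
    have h1 : |(Φ (s, x)).ofLp ⬝ᵥ (w - w')| ≤ Fintype.card ι * a :=
      (abs_dotProduct_le _ _).trans
        ((mul_le_of_le_one_left (l2_nonneg _) hx).trans (l2_le_card_mul hw))
    have h2 : |l2 (B *ᵥ (Φ (s, x)).ofLp) - l2 (B' *ᵥ (Φ (s, x)).ofLp)|
        ≤ Fintype.card ι * (Fintype.card ι * b) := by
      refine (abs_l2_sub_l2_le _ _).trans ?_
      rw [← sub_mulVec]
      exact l2_mulVec_le_card_sq hx hB
    have h3 : ((Φ (s, x)).ofLp ⬝ᵥ w - β * l2 (B *ᵥ (Φ (s, x)).ofLp))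
      - ((Φ (s, x)).ofLp ⬝ᵥ w' - β * l2 (B' *ᵥ (Φ (s, x)).ofLp))
      = (Φ (s, x)).ofLp ⬝ᵥ (w - w')
        - β * (l2 (B *ᵥ (Φ (s, x)).ofLp) - l2 (B' *ᵥ (Φ (s, x)).ofLp)) := by
      rw [dotProduct_sub]; ring
    rw [h3]
    refine (abs_sub _ _).trans (add_le_add h1 ?_)
    rw [abs_mul, abs_of_nonneg hβ]
    exact mul_le_mul_of_nonneg_left h2 hβ
  rw [_root_.abs_le]
  constructor
  · have : V' s ≤ V s + (Fintype.card ι * a + β * (Fintype.card ι * (Fintype.card ι * b))) := by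
      refine (isLUB_le_iff (h'.isLUB s)).2 ?_
      rintro _ ⟨x, rfl⟩
      have h4 := (h.isLUB s).1 ⟨x, rfl⟩
      have h5 := (_root_.abs_le.1 (key x)).1
      dsimp only at h4 ⊢
      linarith
    linarith
  · have : V s ≤ V' s + (Fintype.card ι * a + β * (Fintype.card ι * (Fintype.card ι * b))) := by
      refine (isLUB_le_iff (h.isLUB s)).2 ?_
      rintro _ ⟨x, rfl⟩
      have h4 := (h'.isLUB s).1 ⟨x, rfl⟩
      have h5 := (_root_.abs_le.1 (key x)).2
      dsimp only at h4 ⊢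
      linarith
    linarith

theorem abs_sub_lt_of_floor_eq {x y h : ℝ} (hh : 0 < h) (hf : ⌊x / h⌋ = ⌊y / h⌋) :
    |x - y| < h := by
  have h1 := Int.abs_sub_lt_one_of_floor_eq_floor hf
  rwa [← sub_div, abs_div, abs_of_pos hh, div_lt_one hh] at h1

theorem abs_floor_le {x : ℝ} {m : ℕ} (h : |x| ≤ m) : |⌊x⌋| ≤ m := by
  rw [abs_le] at h ⊢
  exact ⟨Int.le_floor.2 (by push_cast; exact h.1), by
    have := (Int.floor_le x).trans h.2
    exact_mod_cast this⟩

variable [DecidableEq ι]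

/-- A finite family of bounded measurable functions close to every penalized maximum. -/
theorem exists_net_of_isPenalizedMax {Φ : S × A → EuclideanSpace ℝ ι} (hΦ : ∀ q, ‖Φ q‖ ≤ 1)
    {β K W : ℝ} (hβ : 0 ≤ β) (hK : 0 ≤ K) {mw mB : ℕ} (hmB : 0 < mB) {h : ℝ} (hh : 0 < h)
    (hW : W ≤ mw * h) :
    ∃ V : (ι → ℤ) × (ι × ι → ℤ) → S → ℝ, (∀ c, Measurable (V c)) ∧ (∀ c s, |V c s| ≤ K) ∧
      ∀ w B V', IsPenalizedMax Φ β K W w B V' →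
        ∃ c ∈ gridBox ι mw ×ˢ gridBox (ι × ι) mB, ∀ s,
          |V' s - V c s| ≤ Fintype.card ι * h
            + β * (Fintype.card ι * (Fintype.card ι * (1 / mB))) := by
  classical
  have hmB' : (0 : ℝ) < mB := by exact_mod_cast hmB
  -- Each nonempty cell of the parameter space is represented by a member of the class itself.
  -- Measurability and the bound by `K` are thereby inherited, although an arbitrary supremum over
  -- actions need not be measurable. Empty cells get `0`.
  let cell : (ι → ℝ) → Matrix ι ι ℝ → (ι → ℤ) × (ι × ι → ℤ) := fun w B =>
    (fun i => ⌊w i / h⌋, fun p => ⌊B p.1 p.2 / (1 / mB)⌋)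
  let good : (ι → ℤ) × (ι × ι → ℤ) → (S → ℝ) → Prop := fun c V =>
    ∃ w B, IsPenalizedMax Φ β K W w B V ∧ cell w B = c
  refine ⟨fun c => if hc : ∃ V, good c V then hc.choose else 0, fun c => ?_, fun c s => ?_,
    fun w B V' hV' => ⟨cell w B, ?_, fun s => ?_⟩⟩
  · by_cases hc : ∃ V, good c V
    · obtain ⟨w, B, hV, -⟩ := hc.choose_spec
      simpa only [dif_pos hc] using hV.measurable
    · simpa only [dif_neg hc] using measurable_zero
  · by_cases hc : ∃ V, good c V
    · obtain ⟨w, B, hV, -⟩ := hc.choose_spec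
      simpa only [dif_pos hc] using hV.abs_le s
    · simpa [dif_neg hc] using hK
  · refine Finset.mem_product.2 ⟨mem_gridBox.2 fun i => abs_floor_le ?_,
      mem_gridBox.2 fun p => abs_floor_le ?_⟩
    · rw [abs_div, abs_of_pos hh, div_le_iff₀ hh]
      exact (hV'.weight_le i).trans hW
    · rw [div_div_eq_mul_div, div_one, abs_mul, abs_of_pos hmB']
      exact mul_le_of_le_one_left hmB'.le (hV'.entry_le p.1 p.2)
  · have hc : ∃ V, good (cell w B) V := ⟨V', w, B, hV', rfl⟩
    obtain ⟨w', B', hV, hcell⟩ := hc.choose_spec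
    simp only [dif_pos hc]
    refine hV'.abs_sub_le hΦ hβ hV (fun i => ?_) (fun i j => ?_) s
    · exact (abs_sub_lt_of_floor_eq hh (congrFun (congrArg Prod.fst hcell) i).symm).le
    · exact (abs_sub_lt_of_floor_eq (by positivity)
        (congrFun (congrArg Prod.snd hcell) (i, j)).symm).le

end ValueClass

/-! ### Uniform control of the noise with high probability. -/

section Event

open Matrix

variable {S A Ω ι : Type*} [MeasurableSpace S] [MeasurableSpace A] [MeasurableSpace Ω]
  [Fintype ι] [DecidableEq ι] {N : ℕ} {M : MDP S A} {P : Measure Ω} [IsProbabilityMeasure P]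
  {D : Fin N → Ω → Transition S A} {Φ : S × A → EuclideanSpace ℝ ι}

/-- The deviation of the target `R + γ V(s')` from its conditional mean. -/
noncomputable def noise (M : MDP S A) (γ : ℝ) (V : S → ℝ) (x : Transition S A) : ℝ :=
  x.2.1 + γ * V x.2.2 - (M.meanReward x.1 + γ * M.next V x.1)

theorem MDP.RewardBounded.integrable_reward {r : ℝ} (h : M.RewardBounded r) (q : S × A) :
    Integrable (fun p : ℝ × S => p.1) (M.step q) :=
  Integrable.of_bound (by fun_prop) r (h q)

/-- With high probability, the self-normalised noise is small simultaneously for all penalized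
maxima. -/
theorem exists_concentration_event (hΦm : Measurable Φ) (hΦ : ∀ q, ‖Φ q‖ ≤ 1)
    {γ r β K W : ℝ} (hγ : 0 ≤ γ) (hγ1 : γ ≤ 1) (hM : M.RewardBounded r) (hD : IsDatasetOf M P D)
    (hβ : 0 ≤ β) (hK : 0 < K) (hrK : r + γ * K ≤ K) (hd : 0 < Fintype.card ι)
    {mw mB : ℕ} (hmB : 0 < mB) {h : ℝ} (hh : 0 < h) (hW : W ≤ mw * h) {L ε : ℝ} (hL : 0 < L)
    (hε : Fintype.card ι * h + β * (Fintype.card ι * (Fintype.card ι * (1 / mB))) ≤ ε) :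
    ∃ E : Set Ω, MeasurableSet E ∧
      P Eᶜ ≤ ENNReal.ofReal (((2 * (Fintype.card ι * (N + 1)) + 1 : ℕ) ^ Fintype.card ι *
        ((2 * mw + 1 : ℕ) ^ Fintype.card ι * (2 * mB + 1 : ℕ) ^ (Fintype.card ι ^ 2))) *
          Real.exp (-L)) ∧
      ∀ ω ∈ E, (∀ τ, |(D τ ω).2.1| ≤ r) ∧ ∀ w B V, IsPenalizedMax Φ β K W w B V →
        ∀ B₀, IsWhitening (fun τ => (Φ (D τ ω).1).ofLp) B₀ →
          l2 (B₀ *ᵥ ∑ τ, noise M γ V (D τ ω) • (Φ (D τ ω).1).ofLp)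
            ≤ 5 / 2 * K * √L + 4 * N * ε + K := by
  obtain ⟨V, hVm, hVK, hV⟩ := exists_net_of_isPenalizedMax (β := β) (W := W) (mw := mw) hΦ hβ
    hK.le hmB hh hW
  set m := Fintype.card ι * (N + 1) with hm
  -- With `∑ (y · Φ)² ≤ 3` the Chernoff bound reads `t · X ≤ L + 3 L / 2` for the noise sum `X`,
  -- because `t ² K² = L`; this gives `X ≤ 5 / 2 · K √L`.
  set t : ℝ := √L / K with ht
  have hsL : 0 < √L := Real.sqrt_pos.2 hL
  have ht0 : 0 < t := div_pos hsL hK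
  set y : (ι → ℤ) → ι → ℝ := fun k i => (k i : ℝ) / m with hy
  set G : (ι → ℤ) → (ι → ℤ) × (ι × ι → ℤ) → Ω → ℝ := fun k c ω =>
    ∑ τ, (t * (y k ⬝ᵥ (Φ (D τ ω).1).ofLp) * noise M γ (V c) (D τ ω)
      - (t * (y k ⬝ᵥ (Φ (D τ ω).1).ofLp)) ^ 2 * K ^ 2 / 2) with hG
  have hΦc : ∀ k, Measurable fun q => t * (y k ⬝ᵥ (Φ q).ofLp) := fun k => by
    simp only [dotProduct]
    fun_prop
  have hYK : ∀ c q, ∀ᵐ p ∂(M.step q), |p.1 + γ * V c p.2| ≤ K := fun c q => by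
    filter_upwards [hM q] with p hp
    refine (abs_add_le _ _).trans ((add_le_add hp ?_).trans hrK)
    rw [abs_mul, abs_of_nonneg hγ]
    exact mul_le_mul_of_nonneg_left (hVK c _) hγ
  have hYm : ∀ c, Measurable fun p : ℝ × S => p.1 + γ * V c p.2 := fun c =>
    measurable_fst.add (((hVm c).comp measurable_snd).const_mul γ)
  have hmean : ∀ c q, ∫ p, (p.1 + γ * V c p.2) ∂(M.step q)
      = M.meanReward q + γ * M.next (V c) q := fun c q => by
    have hi : Integrable (fun p : ℝ × S => γ * V c p.2) (M.step q) := (integrable_of_abs_le _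
      ((hVm c).comp measurable_snd) fun p => hVK c p.2).const_mul γ
    rw [integral_add (hM.integrable_reward q) hi, integral_const_mul]
    rfl
  have hprob : ∀ k c, P {ω | L ≤ G k c ω} ≤ ENNReal.ofReal (Real.exp (-L)) := fun k c => by
    have := hD.measure_chernoff_le (hYm c) hK.le (hYK c) (hΦc k) L
    simp only [hmean] at this
    exact this
  have hGm : ∀ k c, Measurable (G k c) := fun k c => by
    have hnm : Measurable fun x : Transition S A => noise M γ (V c) x :=
      ((hYm c).comp measurable_snd).sub
        ((M.measurable_meanReward.add ((M.measurable_next (hVm c)).const_mul γ)).comp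
          measurable_fst)
    refine Finset.measurable_sum _ fun τ _ => ?_
    have h1 : Measurable fun ω => t * (y k ⬝ᵥ (Φ (D τ ω).1).ofLp) :=
      (hΦc k).comp (measurable_fst.comp (hD.measurable τ))
    exact (h1.mul (hnm.comp (hD.measurable τ))).sub (((h1.pow_const 2).mul_const _).div_const _)
  -- The union bound runs over pairs of a direction and a net function.
  set I := gridBox ι m ×ˢ (gridBox ι mw ×ˢ gridBox (ι × ι) mB) with hI
  set E₀ : Set Ω := ⋂ τ, {ω | |(D τ ω).2.1| ≤ r} with hE₀
  set F : Set Ω := ⋃ i ∈ I, {ω | L ≤ G i.1 i.2 ω} with hF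
  have hE₀m : MeasurableSet E₀ := MeasurableSet.iInter fun τ =>
    measurableSet_le ((hD.measurable τ).snd.fst.abs) measurable_const
  have hE₀P : P E₀ᶜ = 0 := by
    rw [hE₀, Set.compl_iInter]
    refine measure_iUnion_null fun τ => ?_
    exact ae_iff.1 (hD.ae_of_ae_step (p := fun p : ℝ × S => |p.1| ≤ r)
      (measurableSet_le (measurable_fst.abs) measurable_const) hM τ)
  have hFm : MeasurableSet F := Finset.measurableSet_biUnion _ fun i _ =>
    measurableSet_le measurable_const (hGm i.1 i.2)
  have hcard : I.card = (2 * m + 1) ^ Fintype.card ι *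
      ((2 * mw + 1) ^ Fintype.card ι * (2 * mB + 1) ^ (Fintype.card ι ^ 2)) := by
    rw [hI, Finset.card_product, Finset.card_product, card_gridBox, card_gridBox, card_gridBox,
      Fintype.card_prod, sq]
  refine ⟨E₀ ∩ Fᶜ, hE₀m.inter hFm.compl, ?_, fun ω hω => ⟨fun τ => Set.mem_iInter.1 hω.1 τ,
    fun w B V' hV' B₀ hB₀ => ?_⟩⟩
  · rw [Set.compl_inter, compl_compl]
    refine (measure_union_le _ _).trans ?_
    rw [hE₀P, zero_add]
    refine (measure_biUnion_finset_le _ _).trans ((Finset.sum_le_sum fun i _ =>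
      hprob i.1 i.2).trans_eq ?_)
    rw [Finset.sum_const, hcard, nsmul_eq_mul, ENNReal.ofReal_mul (by positivity)]
    congr 1
    rw [← ENNReal.ofReal_natCast]
    push_cast
    rfl
  · obtain ⟨c, hc, hclose⟩ := hV w B V' hV'
    have hclose' : ∀ s, |V' s - V c s| ≤ ε := fun s => (hclose s).trans hε
    have hr : ∀ τ, |(D τ ω).2.1| ≤ r := fun τ => Set.mem_iInter.1 hω.1 τ
    have hN0 : (0 : ℝ) ≤ N := Nat.cast_nonneg N
    have hε0 : 0 ≤ ε := le_trans (by positivity) hε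
    have hbound : ∀ τ, |noise M γ V' (D τ ω)| ≤ 2 * K := fun τ => by
      have h1 : |(D τ ω).2.1 + γ * V' (D τ ω).2.2| ≤ r + γ * K := by
        refine (abs_add_le _ _).trans (add_le_add (hr τ) ?_)
        rw [abs_mul, abs_of_nonneg hγ]
        exact mul_le_mul_of_nonneg_left (hV'.abs_le _) hγ
      have h2 : |M.meanReward (D τ ω).1 + γ * M.next V' (D τ ω).1| ≤ r + γ * K := by
        refine (abs_add_le _ _).trans (add_le_add (hM.abs_meanReward_le _) ?_)
        rw [abs_mul, abs_of_nonneg hγ]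
        exact mul_le_mul_of_nonneg_left (M.abs_next_le hV'.abs_le _) hγ
      exact (abs_sub _ _).trans (by linarith)
    have hdiff : ∀ τ, |noise M γ V' (D τ ω) - noise M γ (V c) (D τ ω)| ≤ 2 * ε := fun τ => by
      have h1 : noise M γ V' (D τ ω) - noise M γ (V c) (D τ ω)
          = γ * ((V' (D τ ω).2.2 - V c (D τ ω).2.2)
            - (M.next V' (D τ ω).1 - M.next (V c) (D τ ω).1)) := by
        simp only [noise]; ring
      have h2 := hclose' (D τ ω).2.2
      have h3 := M.abs_next_sub_next_le hV'.measurable (hVm c) hV'.abs_le (hVK c) hclose'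
        (D τ ω).1
      rw [h1, abs_mul, abs_of_nonneg hγ]
      refine (mul_le_of_le_one_left (abs_nonneg _) hγ1).trans ((abs_sub _ _).trans ?_)
      linarith
    -- Replacing `V'` by its net neighbour changes each noise term by `2 ε`. A grid vector has norm
    -- at most `2`, so `N` terms cost `4 N ε`. The final `K` is half the noise bound `2 K`, paid for
    -- rounding the direction.
    have hres := hB₀.l2_mulVec_sum_le_of_grid (fun τ => hΦ _) hbound (by positivity)
      (Z := 5 / 2 * K * √L + 4 * N * ε) (by positivity) hd hm fun k hk hk2 hk3 => ?_
    · linarith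
    have hlt : G k c ω < L := by
      by_contra hge
      exact hω.2 (Set.mem_iUnion₂.2 ⟨(k, c), Finset.mem_product.2 ⟨hk, hc⟩, not_lt.1 hge⟩)
    have hsum : y k ⬝ᵥ (∑ τ, noise M γ (V c) (D τ ω) • (Φ (D τ ω).1).ofLp)
        ≤ 5 / 2 * K * √L := by
      have h1 : G k c ω = t * (y k ⬝ᵥ (∑ τ, noise M γ (V c) (D τ ω) • (Φ (D τ ω).1).ofLp))
          - t ^ 2 * K ^ 2 / 2 * ∑ τ, (y k ⬝ᵥ (Φ (D τ ω).1).ofLp) ^ 2 := by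
        simp only [hG]
        rw [dotProduct_sum, Finset.mul_sum, Finset.mul_sum, ← Finset.sum_sub_distrib]
        refine Finset.sum_congr rfl fun τ _ => ?_
        rw [dotProduct_smul, smul_eq_mul]
        ring
      have h2 : t ^ 2 * K ^ 2 = L := by
        rw [ht, div_pow, div_mul_cancel₀ _ (by positivity), Real.sq_sqrt hL.le]
      rw [h1, h2] at hlt
      have h3 : t * (y k ⬝ᵥ (∑ τ, noise M γ (V c) (D τ ω) • (Φ (D τ ω).1).ofLp))
          ≤ t * (5 / 2 * K * √L) := by
        have h4 : t * (5 / 2 * K * √L) = 5 / 2 * L := by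
          have := Real.mul_self_sqrt hL.le
          rw [ht]
          field_simp
          linarith
        have h5 := mul_le_mul_of_nonneg_left hk3 (by positivity : 0 ≤ L / 2)
        rw [h4]
        linarith
      exact le_of_mul_le_mul_left h3 ht0
    have herr : y k ⬝ᵥ (∑ τ, noise M γ V' (D τ ω) • (Φ (D τ ω).1).ofLp)
        - y k ⬝ᵥ (∑ τ, noise M γ (V c) (D τ ω) • (Φ (D τ ω).1).ofLp) ≤ 4 * N * ε := by
      rw [← dotProduct_sub, ← Finset.sum_sub_distrib, dotProduct_sum]
      refine (Finset.sum_le_sum (g := fun _ => 4 * ε) fun τ _ => ?_).trans_eq (by simp; ring)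
      rw [← sub_smul, dotProduct_smul, smul_eq_mul]
      refine (le_abs_self _).trans ?_
      rw [abs_mul]
      have h1 : |y k ⬝ᵥ (Φ (D τ ω).1).ofLp| ≤ 2 :=
        (abs_dotProduct_le _ _).trans ((mul_le_of_le_one_right (l2_nonneg _) (hΦ _)).trans hk2)
      calc _ ≤ 2 * ε * 2 := mul_le_mul (hdiff τ) h1 (abs_nonneg _) (by positivity)
        _ = 4 * ε := by ring
    linarith

end Event

/-! ### From coverage to small expected uncertainty. -/

section Coverage

open Matrix

variable {ι : Type*} [Fintype ι]

/-- With finite `c` and finite numerators, the conventions for division by zero agree with the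
cross-multiplied inequality. -/
theorem coverage_le_iff {U W : Matrix ι ι ℝ} {c : ℝ≥0} :
    coverage U W ≤ c ↔
      ∀ x : ι → ℝ, ENNReal.ofReal (x ⬝ᵥ U *ᵥ x) ≤ c * ENNReal.ofReal (x ⬝ᵥ W *ᵥ x) := by
  rw [coverage, iSup_le_iff]
  exact forall_congr' fun x =>
    ENNReal.div_le_iff_le_mul (Or.inr ENNReal.coe_ne_top) (Or.inl ENNReal.ofReal_ne_top)

theorem dotProduct_mulVec_le_of_coverage_le {U W : Matrix ι ι ℝ} {c : ℝ≥0}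
    (h : coverage U W ≤ c) {x : ι → ℝ} (hx : 0 ≤ x ⬝ᵥ W *ᵥ x) :
    x ⬝ᵥ U *ᵥ x ≤ c * (x ⬝ᵥ W *ᵥ x) := by
  have h1 := coverage_le_iff.1 h x
  rw [← ENNReal.ofReal_coe_nnreal, ← ENNReal.ofReal_mul c.coe_nonneg] at h1
  exact (ENNReal.ofReal_le_ofReal_iff (mul_nonneg c.coe_nonneg hx)).1 h1

variable {S A Ω : Type*} [MeasurableSpace S] [MeasurableSpace A] [MeasurableSpace Ω] {N : ℕ}

omit [MeasurableSpace S] [MeasurableSpace A] in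
theorem dotProduct_dataCov_mulVec (Φ : S × A → EuclideanSpace ℝ ι) (D : Fin N → Transition S A)
    (v : ι → ℝ) :
    v ⬝ᵥ dataCov Φ D *ᵥ v = 1 / N * ∑ τ, (v ⬝ᵥ (Φ (D τ).1).ofLp) ^ 2 := by
  rw [dataCov, smul_mulVec, sum_mulVec, dotProduct_smul, dotProduct_sum, smul_eq_mul]
  congr 1
  refine Finset.sum_congr rfl fun τ _ => ?_
  rw [vecMulVec_mulVec, dotProduct_comm _ v]
  simp only [op_smul_eq_smul, dotProduct_smul, smul_eq_mul, sq]

/-- The condition ranges over possibly uncountably many states and vectors. It depends on the data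
only through finitely many feature vectors, and for these it is an intersection of closed
conditions. -/
theorem measurableSet_coverage_le {Φ : S × A → EuclideanSpace ℝ ι} (hΦ : Measurable Φ)
    {D : Fin N → Ω → Transition S A} (hD : ∀ τ, Measurable (D τ)) {κ : Type*}
    (U : κ → Matrix ι ι ℝ) (c : ℝ≥0) :
    MeasurableSet {ω | ∀ s, coverage (U s) (dataCov Φ fun τ => D τ ω) ≤ c} := by
  have hm : Measurable fun ω => fun τ => (Φ (D τ ω).1).ofLp :=
    measurable_pi_lambda _ fun τ => measurable_pi_lambda _ fun i => by
      have h1 := hΦ.comp (measurable_fst.comp (hD τ))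
      have h2 : Measurable fun v : EuclideanSpace ℝ ι => v i := by fun_prop
      exact h2.comp h1
  have hc : IsClosed {v : Fin N → ι → ℝ | ∀ s, ∀ x : ι → ℝ, ENNReal.ofReal (x ⬝ᵥ U s *ᵥ x)
      ≤ c * ENNReal.ofReal (1 / N * ∑ τ, (x ⬝ᵥ v τ) ^ 2)} := by
    simp only [Set.ofPred_forall]
    refine isClosed_iInter fun s => isClosed_iInter fun x => isClosed_le continuous_const ?_
    refine (ENNReal.continuous_const_mul ENNReal.coe_ne_top).comp
      (ENNReal.continuous_ofReal.comp ?_)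
    simp only [dotProduct]
    fun_prop
  have := hm hc.measurableSet
  convert this using 1
  ext ω
  simp only [coverage_le_iff, dotProduct_dataCov_mulVec, Set.mem_ofPred_eq, Set.mem_preimage]

namespace MDP

variable (M : MDP S A) {γ : ℝ} (π : Kernel S A) [IsMarkovKernel π]

theorem discounted_sum (h0 : 0 ≤ γ) (h1 : γ < 1) {κ : Type*} (I : Finset κ) {f : κ → S × A → ℝ}
    (hf : ∀ k, Measurable (f k)) {C : κ → ℝ} (hC : ∀ k q, |f k q| ≤ C k) (a : κ → ℝ) (s : S) :
    M.discounted γ π (fun q => ∑ k ∈ I, a k * f k q) s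
      = ∑ k ∈ I, a k * M.discounted γ π (f k) s := by
  unfold discounted
  simp only [← tsum_mul_left]
  rw [← Summable.tsum_finsetSum fun k _ =>
    (M.summable_discounted h0 h1 π (hC k) s).mul_left (a k)]
  refine tsum_congr fun t => ?_
  rw [integral_finsetSum _ fun k _ => (integrable_of_abs_le _ (hf k) (hC k)).const_mul _,
    Finset.mul_sum]
  refine Finset.sum_congr rfl fun k _ => ?_
  rw [integral_const_mul]
  ring

theorem discounted_mono (h0 : 0 ≤ γ) (h1 : γ < 1) {f g : S × A → ℝ} (hf : Measurable f)
    (hg : Measurable g) {C C' : ℝ} (hC : ∀ q, |f q| ≤ C) (hC' : ∀ q, |g q| ≤ C')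
    (h : ∀ q, f q ≤ g q) (s : S) : M.discounted γ π f s ≤ M.discounted γ π g s :=
  (M.summable_discounted h0 h1 π hC s).tsum_le_tsum
    (fun t => mul_le_mul_of_nonneg_left (integral_mono (integrable_of_abs_le _ hf hC)
      (integrable_of_abs_le _ hg hC') h) (pow_nonneg h0 t))
    (M.summable_discounted h0 h1 π hC' s)

theorem discounted_const (h0 : 0 ≤ γ) (h1 : γ < 1) (a : ℝ) (s : S) :
    M.discounted γ π (fun _ => a) s = a / (1 - γ) := by
  simp only [discounted, integral_const, probReal_univ, smul_eq_mul, one_mul]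
  rw [tsum_mul_right, tsum_geometric_of_lt_one h0 h1, inv_mul_eq_div]

/-- Jensen's inequality for the discounted occupancy measure. -/
theorem discounted_sq_le (h0 : 0 ≤ γ) (h1 : γ < 1) {f : S × A → ℝ} (hf : Measurable f) {C : ℝ}
    (hC : ∀ q, |f q| ≤ C) (s : S) :
    (1 - γ) * M.discounted γ π f s ^ 2 ≤ M.discounted γ π (fun q => f q ^ 2) s := by
  set F := M.discounted γ π f s with hF
  -- The mean of `f` under the normalised occupancy measure. Jensen's inequality is obtained by
  -- integrating the tangent inequality `f² - a² ≥ 2 a f - 2 a²`.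
  set a := F * (1 - γ) with ha
  have h1' : 0 < 1 - γ := sub_pos.2 h1
  have hsq : ∀ q, |f q ^ 2| ≤ C ^ 2 := fun q => by
    rw [abs_pow]; exact pow_le_pow_left₀ (abs_nonneg _) (hC q) 2
  have hfun : (fun q => f q ^ 2 + (-(a ^ 2))) = fun q => f q ^ 2 + (-(a ^ 2)) * 1 := by simp
  have h2 : M.discounted γ π (fun q => f q ^ 2 + (-(a ^ 2)) * 1) s
      = M.discounted γ π (fun q => f q ^ 2) s + -(a ^ 2) * (1 / (1 - γ)) := by
    rw [M.discounted_add_mul h0 h1 π (hf.pow_const 2) measurable_const hsq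
      (fun _ => le_rfl), M.discounted_const π h0 h1]
  have h3 := M.discounted_mono π h0 h1 (f := fun q => -(2 * a ^ 2) + 2 * a * f q)
    (g := fun q => f q ^ 2 + (-(a ^ 2)) * 1) (by fun_prop) (by fun_prop)
    (C := 2 * a ^ 2 + |2 * a| * C) (C' := C ^ 2 + a ^ 2) (fun q => by
      refine (abs_add_le _ _).trans (add_le_add ?_ ?_)
      · rw [abs_neg, abs_of_nonneg (by positivity)]
      · rw [abs_mul]; exact mul_le_mul_of_nonneg_left (hC q) (abs_nonneg _)) (fun q => by
      refine (abs_add_le _ _).trans (add_le_add (hsq q) ?_)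
      rw [mul_one, abs_neg, abs_of_nonneg (by positivity)])
    (fun q => by nlinarith [sq_nonneg (f q - a)]) s
  rw [h2, M.discounted_add_mul h0 h1 π measurable_const hf (fun _ => le_rfl) hC,
    M.discounted_const π h0 h1, ← hF] at h3
  have h4 : a ^ 2 / (1 - γ) = F ^ 2 * (1 - γ) := by rw [ha]; field_simp
  have h5 : -(2 * a ^ 2) / (1 - γ) = -2 * (a ^ 2 / (1 - γ)) := by ring
  have h6 : -(a ^ 2) * (1 / (1 - γ)) = -(a ^ 2 / (1 - γ)) := by ring
  have h7 : 2 * a * F = 2 * (F ^ 2 * (1 - γ)) := by rw [ha]; ring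
  rw [h5, h6, h7, h4] at h3
  linarith

variable {Φ : S × A → EuclideanSpace ℝ ι}

theorem dotProduct_policyCov_mulVec (h0 : 0 ≤ γ) (h1 : γ < 1) (hΦm : Measurable Φ)
    (hΦ : ∀ q, ‖Φ q‖ ≤ 1) (v : ι → ℝ) (s : S) :
    v ⬝ᵥ M.policyCov γ Φ π s *ᵥ v
      = (1 - γ) * M.discounted γ π (fun q => (v ⬝ᵥ (Φ q).ofLp) ^ 2) s := by
  have hle : ∀ q i, |Φ q i| ≤ 1 := fun q i => (abs_apply_le_l2 (Φ q).ofLp i).trans (hΦ q)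
  have hsq : (fun q => (v ⬝ᵥ (Φ q).ofLp) ^ 2)
      = fun q => ∑ p : ι × ι, (v p.1 * v p.2) * (Φ q p.1 * Φ q p.2) := by
    funext q
    rw [sq, dotProduct, Finset.sum_mul_sum, Fintype.sum_prod_type]
    refine Finset.sum_congr rfl fun i _ => Finset.sum_congr rfl fun j _ => ?_
    ring
  rw [hsq, M.discounted_sum π h0 h1 Finset.univ (f := fun (p : ι × ι) q => Φ q p.1 * Φ q p.2)
    (fun p => by fun_prop) (C := fun _ => 1) (fun p q => by
      rw [abs_mul]; exact mul_le_one₀ (hle _ _) (abs_nonneg _) (hle _ _)),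
    Fintype.sum_prod_type, Finset.mul_sum]
  simp only [dotProduct, mulVec, policyCov, of_apply]
  refine Finset.sum_congr rfl fun i _ => ?_
  rw [Finset.mul_sum, Finset.mul_sum]
  refine Finset.sum_congr rfl fun j _ => ?_
  simp only [discounted]
  ring

end MDP

variable [DecidableEq ι]

omit [Fintype ι] [MeasurableSpace S] [MeasurableSpace A] in
theorem gram_one_eq_ridgeGram (Φ : S × A → EuclideanSpace ℝ ι) (D : Fin N → Transition S A) :
    gram Φ 1 D = ridgeGram fun τ => (Φ (D τ).1).ofLp := by
  rw [gram, ridgeGram, one_smul]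

omit [DecidableEq ι] in
theorem measurable_l2_mulVec {Φ : S × A → EuclideanSpace ℝ ι} (hΦm : Measurable Φ)
    (B : Matrix ι ι ℝ) : Measurable fun q => l2 (B *ᵥ (Φ q).ofLp) := by
  have h : ∀ v, l2 v = √(v ⬝ᵥ v) := fun v : ι → ℝ => by
    rw [dotProduct_self_eq, Real.sqrt_sq (l2_nonneg v)]
  simp only [h, dotProduct, mulVec]
  fun_prop

/-- Under coverage, the policy sees small uncertainty `‖B Φ‖ = √(Φᵀ Λ⁻¹ Φ)` on average. -/
theorem discounted_l2_whitening_le (M : MDP S A) {γ : ℝ} (h0 : 0 ≤ γ) (h1 : γ < 1)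
    (π : Kernel S A) [IsMarkovKernel π] {Φ : S × A → EuclideanSpace ℝ ι} (hΦm : Measurable Φ)
    (hΦ : ∀ q, ‖Φ q‖ ≤ 1) {D : Fin N → Transition S A} (hN : 0 < N) {c : ℝ≥0} {s : S}
    (hcov : coverage (M.policyCov γ Φ π s) (dataCov Φ D) ≤ c) {B : Matrix ι ι ℝ}
    (hB : IsWhitening (fun τ => (Φ (D τ).1).ofLp) B) :
    M.discounted γ π (fun q => l2 (B *ᵥ (Φ q).ofLp)) s
      ≤ √(c * Fintype.card ι / N) / (1 - γ) := by
  have h1' : 0 < 1 - γ := sub_pos.2 h1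
  have hN' : (0 : ℝ) < N := by exact_mod_cast hN
  have hle : ∀ q, |l2 (B *ᵥ (Φ q).ofLp)| ≤ 1 := fun q => by
    rw [abs_of_nonneg (l2_nonneg _)]; exact (hB.l2_mulVec_le _).trans (hΦ q)
  have hm := measurable_l2_mulVec hΦm B
  have hrow : ∀ i q, |B i ⬝ᵥ (Φ q).ofLp| ≤ 1 := fun i q =>
    (abs_apply_le_l2 (B *ᵥ (Φ q).ofLp) i).trans ((hB.l2_mulVec_le _).trans (hΦ q))
  -- Splitting the squared norm into rows of `B` turns the expectation into `d` quadratic forms of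
  -- the policy covariance. By coverage each is at most `c / N` times a sum over the data that does
  -- not exceed `1`.
  have hsq : (fun q => l2 (B *ᵥ (Φ q).ofLp) ^ 2)
      = fun q => ∑ i, 1 * (B i ⬝ᵥ (Φ q).ofLp) ^ 2 := by
    funext q
    rw [← dotProduct_self_eq]
    simp only [dotProduct, mulVec, one_mul, sq]
  have hX : (1 - γ) * M.discounted γ π (fun q => l2 (B *ᵥ (Φ q).ofLp) ^ 2) s
      ≤ c * Fintype.card ι / N := by
    rw [hsq, M.discounted_sum π h0 h1 Finset.univ (f := fun i q => (B i ⬝ᵥ (Φ q).ofLp) ^ 2)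
      (fun i => by simp only [dotProduct]; fun_prop) (C := fun _ => 1) (fun i q => by
        rw [abs_pow]; exact pow_le_one₀ (abs_nonneg _) (hrow i q)), Finset.mul_sum]
    have hi : ∀ i, (1 - γ) * (1 * M.discounted γ π (fun q => (B i ⬝ᵥ (Φ q).ofLp) ^ 2) s)
        ≤ c / N := fun i => by
      rw [one_mul, ← M.dotProduct_policyCov_mulVec π h0 h1 hΦm hΦ]
      have hd := dotProduct_dataCov_mulVec Φ D (B i)
      have hg := hB.dotProduct_gram_row i
      rw [dotProduct_ridgeGram_mulVec, dotProduct_self_eq] at hg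
      have hs : ∑ τ, (B i ⬝ᵥ (Φ (D τ).1).ofLp) ^ 2 ≤ 1 := by nlinarith [l2_nonneg (B i)]
      refine (dotProduct_mulVec_le_of_coverage_le hcov ?_).trans ?_
      · rw [hd]
        exact mul_nonneg (by positivity) (Finset.sum_nonneg fun _ _ => sq_nonneg _)
      · rw [hd, div_eq_mul_one_div (c : ℝ)]
        exact mul_le_mul_of_nonneg_left (mul_le_of_le_one_right (by positivity) hs) c.2
    refine (Finset.sum_le_sum fun i _ => hi i).trans_eq ?_
    simp [Finset.card_univ]
    ring
  have hJ := M.discounted_sq_le π h0 h1 hm hle s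
  rw [le_div_iff₀ h1']
  refine Real.le_sqrt_of_sq_le (le_trans ?_ hX)
  nlinarith

end Coverage

/-! ### Size of the nets against the failure probability. -/

section Numeric

/-- The union bound over the nets is absorbed by the exponent `121 d² log X`. -/
theorem union_bound_le {d N mw mB : ℕ} (hd : 0 < d) (hN : 0 < N) {γ δ X ζ : ℝ} (h0 : 0 ≤ γ)
    (h1 : γ < 1) (hδ : 0 < δ) (hδ1 : δ < 1) (hX : X = 4 * d * N / ((1 - γ) * δ))
    (hζ : ζ = Real.log X) (hmw : mw = 6 * N ^ 2 * d)
    (hmB : mB = ⌈200 * N * (d : ℝ) ^ 3 * √ζ⌉₊) :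
    1 ≤ ζ ∧ ((2 * (d * (N + 1)) + 1 : ℕ) ^ d *
      ((2 * mw + 1 : ℕ) ^ d * (2 * mB + 1 : ℕ) ^ (d ^ 2)) : ℝ)
      * Real.exp (-(121 * d ^ 2 * ζ)) ≤ δ / 2 := by
  have hd1 : (1 : ℝ) ≤ d := by exact_mod_cast hd
  have hN1 : (1 : ℝ) ≤ N := by exact_mod_cast hN
  have h1' : 0 < 1 - γ := sub_pos.2 h1
  have hdN : (1 : ℝ) ≤ d * N := one_le_mul_of_one_le_of_one_le hd1 hN1
  have hX4 : 4 * d * N ≤ X := by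
    rw [hX, le_div_iff₀ (by positivity)]
    exact mul_le_of_le_one_right (by positivity) (mul_le_one₀ (by linarith) hδ.le hδ1.le)
  have hX4' : 4 ≤ X := by nlinarith
  have hX0 : 0 < X := by linarith
  have hX1 : 1 ≤ X := by linarith
  have hdX : (d : ℝ) ≤ X := by nlinarith
  have hNX : (N : ℝ) ≤ X := by nlinarith
  have hζ1 : 1 ≤ ζ := by
    rw [hζ, Real.le_log_iff_exp_le hX0]
    linarith [Real.exp_one_lt_d9]
  have hζX : √ζ ≤ X := by
    refine (Real.sqrt_le_iff.2 ⟨by linarith, by nlinarith⟩ : √ζ ≤ ζ).trans ?_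
    rw [hζ]
    exact (Real.log_le_sub_one_of_pos hX0).trans (by linarith)
  have hs0 : 1 ≤ √ζ := Real.one_le_sqrt.2 hζ1
  refine ⟨hζ1, ?_⟩
  have e1 : ((2 * (d * (N + 1)) + 1 : ℕ) : ℝ) ≤ X ^ 2 := by
    push_cast
    nlinarith
  have e2 : ((2 * mw + 1 : ℕ) : ℝ) ≤ X ^ 2 := by
    rw [hmw]
    push_cast
    have : (4 * d * N) ^ 2 ≤ X ^ 2 := pow_le_pow_left₀ (by positivity) hX4 2
    nlinarith [mul_le_mul_of_nonneg_left hd1 (by positivity : (0 : ℝ) ≤ d * N ^ 2),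
      mul_le_mul hdN hdN zero_le_one (by positivity)]
  have e3 : ((2 * mB + 1 : ℕ) : ℝ) ≤ X ^ 10 := by
    have hc : (mB : ℝ) ≤ 201 * (N * (d : ℝ) ^ 3 * √ζ) := by
      rw [hmB]
      refine (Nat.ceil_lt_add_one (by positivity)).le.trans ?_
      have : 1 ≤ N * (d : ℝ) ^ 3 * √ζ :=
        one_le_mul_of_one_le_of_one_le (one_le_mul_of_one_le_of_one_le hN1 (one_le_pow₀ hd1)) hs0
      linarith
    have hp : N * (d : ℝ) ^ 3 * √ζ ≤ X * X ^ 3 * X := by gcongr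
    have h5 : (1024 : ℝ) ≤ X ^ 5 := by
      calc (1024 : ℝ) = 4 ^ 5 := by norm_num
        _ ≤ X ^ 5 := pow_le_pow_left₀ (by norm_num) hX4' 5
    have h6 : 1 ≤ X ^ 5 := one_le_pow₀ hX1
    push_cast
    have h7 : X ^ 10 = X ^ 5 * X ^ 5 := by ring
    have h8 : X * X ^ 3 * X = X ^ 5 := by ring
    rw [h8] at hp
    nlinarith
  have hexp : Real.exp (-(121 * d ^ 2 * ζ)) = (X ^ (121 * d ^ 2))⁻¹ := by
    have : (121 * d ^ 2 : ℝ) = ((121 * d ^ 2 : ℕ) : ℝ) := by push_cast; rfl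
    rw [Real.exp_neg, hζ, mul_comm, Real.exp_mul, Real.exp_log hX0, this, Real.rpow_natCast]
  have hprod : (((2 * (d * (N + 1)) + 1 : ℕ) : ℝ) ^ d *
      (((2 * mw + 1 : ℕ) : ℝ) ^ d * ((2 * mB + 1 : ℕ) : ℝ) ^ (d ^ 2))) ≤ X ^ (120 * d ^ 2) := by
    calc _ ≤ (X ^ 2) ^ d * ((X ^ 2) ^ d * (X ^ 10) ^ (d ^ 2)) := by gcongr
      _ = X ^ (2 * d + (2 * d + 10 * d ^ 2)) := by ring
      -- The exponents add up to `4 d + 10 d² ≤ 14 d²`, so there is ample room. The spare factor `X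
      -- ^ (d ^ 2) ≥ X` then pays for `δ / 2`.
      _ ≤ X ^ (120 * d ^ 2) := pow_le_pow_right₀ hX1 (by nlinarith)
  rw [hexp]
  refine (mul_le_mul_of_nonneg_right hprod (by positivity)).trans ?_
  have h9 : X ^ (121 * d ^ 2) = X ^ (120 * d ^ 2) * X ^ (d ^ 2) := by rw [← pow_add]; congr 1; ring
  rw [h9, mul_inv, ← mul_assoc, mul_inv_cancel₀ (by positivity), one_mul]
  have h10 : X ≤ X ^ (d ^ 2) := le_self_pow₀ hX1 (by positivity)
  refine (inv_anti₀ hX0 h10).trans ?_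
  rw [hX, inv_div, div_le_div_iff₀ (by positivity) (by positivity)]
  have : (1 - γ) * δ ≤ δ := mul_le_of_le_one_left hδ.le (by linarith)
  nlinarith

end Numeric

/-! ### Pessimistic value iteration under accurate regression. -/

section PessimisticIteration

open Matrix

variable {S A ι : Type*} [MeasurableSpace S] [MeasurableSpace A] [Fintype ι] [DecidableEq ι]
  {N : ℕ} {M : MDP S A} {D : Fin N → Transition S A} {Φ : S × A → EuclideanSpace ℝ ι}
  {B : Matrix ι ι ℝ} {γ β r H : ℝ}

omit [MeasurableSpace S] [MeasurableSpace A] in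
theorem penalty_eq (hB : IsWhitening (fun τ => (Φ (D τ).1).ofLp) B) (β : ℝ) (q : S × A) :
    penalty Φ 1 β D q = β * l2 (B *ᵥ (Φ q).ofLp) := by
  rw [penalty, gram_one_eq_ridgeGram, hB.sqrt_dotProduct_inv_mulVec]

omit [MeasurableSpace S] [MeasurableSpace A] in
theorem l2_ridgeWeight_le (hB : IsWhitening (fun τ => (Φ (D τ).1).ofLp) B)
    (hΦ : ∀ q, ‖Φ q‖ ≤ 1) {V : S → ℝ} {K : ℝ}
    (hK : ∀ τ, |(D τ).2.1 + γ * V (D τ).2.2| ≤ K) : l2 (ridgeWeight γ Φ 1 D V) ≤ N * K := by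
  rw [ridgeWeight, gram_one_eq_ridgeGram]
  refine (hB.l2_inv_mulVec_le _).trans ((l2_sum_le _ _).trans ?_)
  refine (Finset.sum_le_sum (g := fun _ => K) fun τ _ => ?_).trans_eq (by simp)
  rw [l2_smul]
  exact (mul_le_of_le_one_right (abs_nonneg _) (hΦ _)).trans (hK τ)

omit [MeasurableSpace S] [MeasurableSpace A] in
-- The value function enters only through its values at the finitely many observed next states, so
-- pointwise convergence is enough.
theorem tendsto_ridgeWeight {V : ℕ → S → ℝ} {Vhat : S → ℝ}
    (h : ∀ s, Tendsto (fun k => V k s) atTop (𝓝 (Vhat s))) :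
    Tendsto (fun k => ridgeWeight γ Φ 1 D (V k)) atTop (𝓝 (ridgeWeight γ Φ 1 D Vhat)) := by
  have hc : Continuous fun v : ι → ℝ => (gram Φ 1 D)⁻¹ *ᵥ v :=
    Continuous.matrix_mulVec continuous_const continuous_id
  refine (hc.tendsto _).comp (tendsto_finsetSum _ fun τ _ => ?_)
  exact ((tendsto_const_nhds.add ((h _).const_mul γ)).smul_const _)

theorem measurable_pessQ (hB : IsWhitening (fun τ => (Φ (D τ).1).ofLp) B) (hΦm : Measurable Φ)
    (V : S → ℝ) : Measurable (pessQ γ Φ 1 β D V) := by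
  have h1 := measurable_l2_mulVec hΦm B
  have h2 : Measurable fun q => (Φ q).ofLp ⬝ᵥ ridgeWeight γ Φ 1 D V := by
    simp only [dotProduct]; fun_prop
  have h3 : pessQ γ Φ 1 β D V
      = fun q => (Φ q).ofLp ⬝ᵥ ridgeWeight γ Φ 1 D V - β * l2 (B *ᵥ (Φ q).ofLp) := by
    funext q; rw [pessQ, penalty_eq hB]
  rw [h3]
  exact h2.sub (h1.const_mul β)

omit [MeasurableSpace S] [MeasurableSpace A] in
theorem exists_abs_pessQ_le (hB : IsWhitening (fun τ => (Φ (D τ).1).ofLp) B)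
    (hΦ : ∀ q, ‖Φ q‖ ≤ 1) (V : S → ℝ) : ∃ C, ∀ q, |pessQ γ Φ 1 β D V q| ≤ C := by
  refine ⟨l2 (ridgeWeight γ Φ 1 D V) + |β|, fun q => ?_⟩
  rw [pessQ, penalty_eq hB]
  refine (abs_sub _ _).trans (add_le_add ?_ ?_)
  · exact (abs_dotProduct_le _ _).trans (mul_le_of_le_one_left (l2_nonneg _) (hΦ q))
  · rw [abs_mul, abs_of_nonneg (l2_nonneg _)]
    exact mul_le_of_le_one_right (abs_nonneg _) ((hB.l2_mulVec_le _).trans (hΦ q))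

/-- An average that dominates every value must equal their supremum. The iterates are therefore
suprema over actions, independent of which greedy policies are chosen. -/
theorem IsGreedy.isLUB {π : Kernel S A} {Q : S × A → ℝ} (h : IsGreedy π Q) (hQ : Measurable Q)
    {C : ℝ} (hC : ∀ q, |Q q| ≤ C) (s : S) :
    IsLUB (Set.range fun a => Q (s, a)) (∫ a, Q (s, a) ∂(π s)) := by
  have := h.1
  refine ⟨?_, fun u hu => ?_⟩
  · rintro _ ⟨a, rfl⟩
    exact h.2 s a
  · exact integral_le_of_le _
      (integrable_of_abs_le _ (hQ.comp measurable_prodMk_left) fun a => hC (s, a))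
      fun a => hu ⟨a, rfl⟩

/-- If ridge regression is accurate up to the penalty for every value function of the class, the
policy returned by pessimistic value iteration loses at most twice the expected penalty. -/
theorem IsPEVIOutput.suboptimality_le (h0 : 0 ≤ γ) (h1 : γ < 1) (hΦm : Measurable Φ)
    (hΦ : ∀ q, ‖Φ q‖ ≤ 1) (hM : M.RewardBounded r) (hH : r + γ * H = H) (hH0 : 0 ≤ H)
    (hr0 : 0 ≤ r) (hβ : 0 ≤ β) (hB : IsWhitening (fun τ => (Φ (D τ).1).ofLp) B)
    (hr : ∀ τ, |(D τ).2.1| ≤ r)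
    (hval : ∀ w B' V, IsPenalizedMax Φ β (3 * H) (N * (3 * H)) w B' V → ∀ q,
      |(Φ q).ofLp ⬝ᵥ ridgeWeight γ Φ 1 D V - (M.meanReward q + γ * M.next V q)|
        ≤ β * l2 (B *ᵥ (Φ q).ofLp))
    {πstar : Kernel S A} [IsMarkovKernel πstar]
    (hpen : ∀ s, β * M.discounted γ πstar (fun q => l2 (B *ᵥ (Φ q).ofLp)) s ≤ H)
    {πhat : Kernel S A} (hπ : IsPEVIOutput γ Φ 1 β D πhat) (s : S) :
    M.J γ πstar s - M.J γ πhat s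
      ≤ 2 * (β * M.discounted γ πstar (fun q => l2 (B *ᵥ (Φ q).ofLp)) s) := by
  obtain ⟨V, π, Vhat, hV0, hπk, hVs, hlim, hhat⟩ := hπ
  set ν : S × A → ℝ := fun q => l2 (B *ᵥ (Φ q).ofLp) with hν
  have hνm : Measurable ν := measurable_l2_mulVec hΦm B
  have hν0 : ∀ q, 0 ≤ ν q := fun q => l2_nonneg _
  have hν1 : ∀ q, |ν q| ≤ 1 := fun q => by
    rw [abs_of_nonneg (hν0 q)]; exact (hB.l2_mulVec_le _).trans (hΦ q)
  have hQm : ∀ U, Measurable (pessQ γ Φ 1 β D U) := fun U => measurable_pessQ hB hΦm U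
  have hQb := fun U => exists_abs_pessQ_le (γ := γ) (β := β) hB hΦ U
  choose CQ hCQ using hQb
  have hQeq : ∀ U q, pessQ γ Φ 1 β D U q = (Φ q).ofLp ⬝ᵥ ridgeWeight γ Φ 1 D U - β * ν q :=
    fun U q => by rw [pessQ, penalty_eq hB]
  have hVm : ∀ k, Measurable (V k) := fun k => by
    cases k with
    | zero => rw [show V 0 = fun _ => 0 from funext hV0]; exact measurable_const
    | succ k =>
      have := (hπk k).1
      rw [show V (k + 1) = _ from funext (hVs k)]
      exact measurable_integral_kernel_prod _ (hQm _)
  have hVb : ∀ k, ∃ C, ∀ s, |V k s| ≤ C := fun k => by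
    cases k with
    | zero => exact ⟨0, fun s => by simp [hV0]⟩
    | succ k =>
      have := (hπk k).1
      refine ⟨CQ (V k), fun s => ?_⟩
      rw [hVs]
      exact abs_integral_le_of_abs_le _ fun a => hCQ _ _
  have hLUB : ∀ k s, IsLUB (Set.range fun a => pessQ γ Φ 1 β D (V k) (s, a)) (V (k + 1) s) :=
    fun k s => by
      rw [hVs]; exact (hπk k).isLUB (hQm _) (hCQ _) s
  have hrm := hM.abs_meanReward_le
  set f : S × A → ℝ := fun q => M.meanReward q + -(2 * β) * ν q with hf
  have hfm : Measurable f := M.measurable_meanReward.add (hνm.const_mul _)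
  have hfb : ∀ q, |f q| ≤ r + 2 * β := fun q => by
    refine (abs_add_le _ _).trans (add_le_add (hrm q) ?_)
    rw [abs_mul, abs_neg, abs_of_nonneg (by positivity : 0 ≤ 2 * β)]
    exact mul_le_of_le_one_right (by positivity) (hν1 q)
  -- accuracy gives two-sided bounds on the pessimistic estimate
  have hbounds : ∀ U : S → ℝ, (∀ q, |(Φ q).ofLp ⬝ᵥ ridgeWeight γ Φ 1 D U
      - (M.meanReward q + γ * M.next U q)| ≤ β * ν q) → ∀ q,
      f q + γ * M.next U q ≤ pessQ γ Φ 1 β D U q ∧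
        pessQ γ Φ 1 β D U q ≤ M.meanReward q + γ * M.next U q := fun U hU q => by
    have := abs_le.1 (hU q)
    rw [hQeq, hf]
    constructor <;> dsimp only <;> linarith
  have hstepOf : ∀ U U' : S → ℝ, Measurable U → (∃ C, ∀ s, |U s| ≤ C) →
      (∀ q, f q + γ * M.next U q ≤ pessQ γ Φ 1 β D U q) →
      (∀ s a, pessQ γ Φ 1 β D U (s, a) ≤ U' s) → ∀ s,
      ∫ q, (f q + γ * M.next U q) ∂(MDP.act πstar s) ≤ U' s := by
    rintro U U' hUm ⟨C, hC⟩ hle hU' s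
    have hm : Measurable fun q => f q + γ * M.next U q :=
      hfm.add ((M.measurable_next hUm).const_mul γ)
    rw [MDP.integral_act _ hm]
    refine integral_le_of_le _ (integrable_of_abs_le _ (C := r + 2 * β + γ * C)
      (hm.comp measurable_prodMk_left) fun a => ?_) fun a => (hle _).trans (hU' s a)
    refine (abs_add_le _ _).trans (add_le_add (hfb _) ?_)
    rw [abs_mul, abs_of_nonneg h0]
    exact mul_le_mul_of_nonneg_left (M.abs_next_le hC _) h0
  -- The rewards account for `-H` and the doubled penalty along `π*` for `-2 H`.
  have hpartial : ∀ n s, -(3 * H) ≤ ∑ j ∈ Finset.range n,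
      γ ^ j * ∫ q, f q ∂(M.visit πstar j s) := fun n s => by
    have h2 : ∀ j, γ ^ j * ∫ q, f q ∂(M.visit πstar j s)
        = γ ^ j * ∫ q, M.meanReward q ∂(M.visit πstar j s)
          - 2 * β * (γ ^ j * ∫ q, ν q ∂(M.visit πstar j s)) := fun j => by
      rw [hf, integral_add (integrable_of_abs_le _ M.measurable_meanReward hrm)
        ((integrable_of_abs_le _ hνm hν1).const_mul _), integral_const_mul]
      ring
    have h3 : ∑ j ∈ Finset.range n, γ ^ j * ∫ q, ν q ∂(M.visit πstar j s)
        ≤ M.discounted γ πstar ν s :=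
      (M.summable_discounted h0 h1 πstar hν1 s).sum_le_tsum _ fun j _ =>
        mul_nonneg (pow_nonneg h0 j) (integral_nonneg hν0)
    have h4 : ∑ j ∈ Finset.range n, γ ^ j * (-r)
        ≤ ∑ j ∈ Finset.range n, γ ^ j * ∫ q, M.meanReward q ∂(M.visit πstar j s) :=
      Finset.sum_le_sum fun j _ => mul_le_mul_of_nonneg_left
        (abs_le.1 (abs_integral_le_of_abs_le _ hrm)).1 (pow_nonneg h0 j)
    have h5 : ∑ j ∈ Finset.range n, γ ^ j * r ≤ H := by
      rw [← Finset.sum_mul]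
      have h6 : (∑ j ∈ Finset.range n, γ ^ j) ≤ (1 - γ)⁻¹ := by
        rw [← tsum_geometric_of_lt_one h0 h1]
        exact (summable_geometric_of_lt_one h0 h1).sum_le_tsum _ fun j _ => pow_nonneg h0 j
      have h7 : H = (1 - γ)⁻¹ * r := by
        have : 1 - γ ≠ 0 := (sub_pos.2 h1).ne'
        field_simp
        linarith
      rw [h7]
      exact mul_le_mul_of_nonneg_right h6 hr0
    simp only [h2, Finset.sum_sub_distrib, ← Finset.mul_sum]
    simp only [mul_neg, Finset.sum_neg_distrib] at h4
    have h8 := mul_le_mul_of_nonneg_left h3 (by positivity : 0 ≤ 2 * β)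
    linarith [hpen s]
  -- Strong induction: the lower bound at round `k + 1` compares with `π*` through all earlier
  -- rounds, and accuracy is available there only because those iterates lie in the class.
  have hclass : ∀ k, (∃ w B', IsPenalizedMax Φ β (3 * H) (N * (3 * H)) w B' (V k)) ∧
      ∀ s, V k s ≤ H := by
    intro k
    induction k using Nat.strong_induction_on with
    | _ k ih =>
      cases k with
      | zero =>
        refine ⟨⟨0, 0, hVm 0, fun s => ?_, fun i => ?_, fun i j => ?_, fun s => ?_⟩, fun s => ?_⟩
        · rw [hV0, abs_zero]; positivity
        · rw [Pi.zero_apply, abs_zero]; positivity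
        · simp
        · have := (hπk 0).1
          have : Nonempty A := nonempty_of_isProbabilityMeasure (π 0 s)
          -- The zero function is the penalized maximum with `w = 0` and `B = 0`, provided there is
          -- an action.
          have hz : l2 (0 : ι → ℝ) = 0 := by simp [l2]
          simp only [dotProduct_zero, zero_mulVec, hz, mul_zero, sub_zero, hV0, Set.range_const]
          exact isLUB_singleton
        · rw [hV0]; exact hH0
      | succ k =>
        have hupper : ∀ s, V (k + 1) s ≤ H := fun s => by
          obtain ⟨⟨w, B', hc⟩, hle⟩ := ih k (Nat.lt_succ_self k)
          refine (hLUB k s).2 ?_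
          rintro _ ⟨a, rfl⟩
          refine (hbounds _ (hval w B' _ hc) (s, a)).2.trans ?_
          rw [← hH]
          exact add_le_add (abs_le.1 (hrm _)).2 (mul_le_mul_of_nonneg_left
            (M.next_le hc.measurable hc.abs_le hle _) h0)
        have hlower : ∀ s, -(3 * H) ≤ V (k + 1) s := fun s => by
          have := M.sum_le_of_bellman_le h0 πstar hfm hfb hVm hVb (m := 0)
            (fun s => by rw [hV0]; simp) (k + 1) (fun j hj => by
              obtain ⟨⟨w, B', hc⟩, -⟩ := ih j hj
              exact hstepOf _ _ (hVm j) (hVb j) (fun q => (hbounds _ (hval w B' _ hc) q).1)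
                fun s a => (hLUB j s).1 ⟨a, rfl⟩) s
          rw [mul_zero, sub_zero] at this
          exact (hpartial _ s).trans this
        refine ⟨⟨ridgeWeight γ Φ 1 D (V k), B, hVm _, fun s => ?_, fun i => ?_, hB.abs_apply_le,
          fun s => ?_⟩, hupper⟩
        · exact abs_le.2 ⟨hlower s, (hupper s).trans (by linarith)⟩
        · obtain ⟨⟨w, B', hc⟩, hle⟩ := ih k (Nat.lt_succ_self k)
          refine (abs_apply_le_l2 _ i).trans (l2_ridgeWeight_le hB hΦ fun τ => ?_)
          refine (abs_add_le _ _).trans ((add_le_add (hr τ) (?_ : _ ≤ γ * (3 * H))).trans ?_)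
          · rw [abs_mul, abs_of_nonneg h0]
            exact mul_le_mul_of_nonneg_left (hc.abs_le _) h0
          · linarith
        · have := hLUB k s
          simp only [hQeq] at this
          exact this
  have hVK : ∀ k s, |V k s| ≤ 3 * H := fun k s => by
    obtain ⟨⟨w, B', hc⟩, -⟩ := hclass k
    exact hc.abs_le s
  have hVhatm : Measurable Vhat := measurable_of_tendsto_metrizable hVm (tendsto_pi_nhds.2 hlim)
  have hVhatK : ∀ s, |Vhat s| ≤ 3 * H := fun s => le_of_tendsto' (hlim s).abs fun k => hVK k s
  have hnext : ∀ q, Tendsto (fun k => M.next (V k) q) atTop (𝓝 (M.next Vhat q)) := fun q =>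
    tendsto_integral_of_dominated_convergence (fun _ => 3 * H)
      (fun k => ((hVm k).comp measurable_snd).aestronglyMeasurable) (integrable_const _)
      (fun k => ae_of_all _ fun p => hVK k p.2) (ae_of_all _ fun p => hlim p.2)
  have hridge := tendsto_ridgeWeight (γ := γ) (Φ := Φ) (D := D) hlim
  have hdot : ∀ v : ι → ℝ, Tendsto (fun k => v ⬝ᵥ ridgeWeight γ Φ 1 D (V k)) atTop
      (𝓝 (v ⬝ᵥ ridgeWeight γ Φ 1 D Vhat)) := fun v => by
    have hc : Continuous fun u : ι → ℝ => v ⬝ᵥ u := by simp only [dotProduct]; fun_prop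
    exact (hc.tendsto _).comp hridge
  -- Accuracy is a closed condition and passes to the limit, so membership of `Vhat` in the class is
  -- not needed.
  have hhatb := hbounds Vhat fun q => le_of_tendsto'
    ((hdot _).sub (((hnext q).const_mul γ).const_add _)).abs fun k => by
      obtain ⟨⟨w, B', hc⟩, -⟩ := hclass k
      exact hval w B' _ hc q
  have hge : ∀ s a, pessQ γ Φ 1 β D Vhat (s, a) ≤ Vhat s := fun s a => by
    refine le_of_tendsto_of_tendsto' (f := fun k => pessQ γ Φ 1 β D (V k) (s, a)) ?_
      ((tendsto_add_atTop_iff_nat 1).2 (hlim s)) fun k => (hLUB k s).1 ⟨a, rfl⟩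
    simp only [hQeq]
    exact (hdot _).sub_const _
  have := hhat.1
  -- `Q̂` depends on the value function only through the weight vector. Since `‖Φ‖ ≤ 1`, convergence
  -- of the weights is convergence of `Q̂` uniformly over actions, which lets the supremum pass to
  -- the limit.
  have hle : ∀ s, Vhat s ≤ ∫ a, pessQ γ Φ 1 β D Vhat (s, a) ∂(πhat s) := fun s => by
    have ht : Tendsto (fun k => ∫ a, pessQ γ Φ 1 β D Vhat (s, a) ∂(πhat s)
        + l2 (ridgeWeight γ Φ 1 D (V k) - ridgeWeight γ Φ 1 D Vhat)) atTop
        (𝓝 (∫ a, pessQ γ Φ 1 β D Vhat (s, a) ∂(πhat s) + 0)) := by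
      refine tendsto_const_nhds.add ?_
      have hc : Continuous fun u : ι → ℝ => l2 (u - ridgeWeight γ Φ 1 D Vhat) := by
        unfold l2; fun_prop
      have := (hc.tendsto (ridgeWeight γ Φ 1 D Vhat)).comp hridge
      simpa [l2, Function.comp_def] using this
    rw [add_zero] at ht
    refine le_of_tendsto_of_tendsto' ((tendsto_add_atTop_iff_nat 1).2 (hlim s)) ht fun k => ?_
    refine (hLUB k s).2 ?_
    rintro _ ⟨a, rfl⟩
    have h2 := hhat.2 s a
    have h3 := (le_abs_self _).trans ((abs_dotProduct_le (Φ (s, a)).ofLp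
      (ridgeWeight γ Φ 1 D (V k) - ridgeWeight γ Φ 1 D Vhat)).trans
      (mul_le_of_le_one_left (l2_nonneg _) (hΦ _)))
    rw [dotProduct_sub] at h3
    rw [hQeq] at h2
    dsimp only
    rw [hQeq]
    linarith
  have hlow : M.discounted γ πstar f s ≤ Vhat s :=
    M.discounted_le_of_bellman_le h0 h1 πstar hfm hfb hVhatm hVhatK
      (hstepOf Vhat Vhat hVhatm ⟨_, hVhatK⟩ (fun q => (hhatb q).1) hge) s
  have hup : Vhat s ≤ M.discounted γ πhat M.meanReward s := by
    refine M.le_discounted_of_le_bellman h0 h1 πhat M.measurable_meanReward hrm hVhatm hVhatK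
      (fun s => (hle s).trans ?_) s
    have hm : Measurable fun q => M.meanReward q + γ * M.next Vhat q :=
      M.measurable_meanReward.add ((M.measurable_next hVhatm).const_mul γ)
    rw [MDP.integral_act _ hm]
    refine integral_mono
      (integrable_of_abs_le _ ((hQm _).comp measurable_prodMk_left) fun a => hCQ _ _)
      (integrable_of_abs_le _ (hm.comp measurable_prodMk_left) (C := r + γ * (3 * H))
        fun a => ?_) fun a => (hhatb _).2
    refine (abs_add_le _ _).trans (add_le_add (hrm _) ?_)
    rw [abs_mul, abs_of_nonneg h0]
    exact mul_le_mul_of_nonneg_left (M.abs_next_le hVhatK _) h0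
  rw [hf, M.discounted_add_mul h0 h1 πstar M.measurable_meanReward hνm hrm hν1] at hlow
  have hJ : ∀ π' : Kernel S A, M.J γ π' s = M.discounted γ π' M.meanReward s := fun _ => rfl
  rw [hJ, hJ]
  linarith

end PessimisticIteration

/-! ### Accuracy event and guarantee for a general linear MDP. -/

section Guarantee

open Matrix

variable {S A Ω ι : Type*} [MeasurableSpace S] [MeasurableSpace A] [MeasurableSpace Ω]
  [Fintype ι] {N : ℕ} {M : MDP S A} {P : Measure Ω} [IsProbabilityMeasure P]
  {D : Fin N → Ω → Transition S A} {Φ : S × A → EuclideanSpace ℝ ι}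

/-- In dimension zero the total mass `1` would be an empty inner product. -/
theorem MDP.IsLinear.card_pos {r : ℝ} (h : M.IsLinear Φ r) (q : S × A) : 0 < Fintype.card ι := by
  obtain ⟨-, -, ⟨μ, -, hμ⟩, -⟩ := h
  rw [Fintype.card_pos_iff]
  by_contra hι
  rw [not_nonempty_iff] at hι
  have := hμ q _ MeasurableSet.univ
  rw [Set.preimage_univ, probReal_univ, inner_eq_dotProduct] at this
  simp [dotProduct] at this

theorem MDP.J_sub_le (h0 : MDP.RewardBounded M r) {γ : ℝ} (hγ0 : 0 ≤ γ) (hγ1 : γ < 1)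
    (π π' : Kernel S A) [IsMarkovKernel π] [IsMarkovKernel π'] (s : S) :
    M.J γ π s - M.J γ π' s ≤ 2 * r / (1 - γ) := by
  have h1 := M.abs_discounted_le hγ0 hγ1 π h0.abs_meanReward_le s
  have h2 := M.abs_discounted_le hγ0 hγ1 π' h0.abs_meanReward_le s
  have h3 : 2 * r / (1 - γ) = r / (1 - γ) + r / (1 - γ) := by ring
  rw [h3]
  have := abs_le.1 h1
  have := abs_le.1 h2
  have hJ : ∀ π'' : Kernel S A, M.J γ π'' s = M.discounted γ π'' M.meanReward s := fun _ => rfl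
  rw [hJ, hJ]
  linarith

variable [DecidableEq ι]

/-- The event on which ridge regression is accurate up to the penalty. -/
theorem exists_accuracy_event {γ r H β δ ζ : ℝ} (h0 : 0 ≤ γ) (h1 : γ < 1) (hr0 : 0 < r)
    (hδ : 0 < δ) (hδ1 : δ < 1) (hN : 0 < N) (hd : 0 < Fintype.card ι) (hM : M.RewardBounded r)
    (hlin : M.IsLinear Φ r) (hD : IsDatasetOf M P D)
    (hζ : ζ = Real.log (4 * Fintype.card ι * N / ((1 - γ) * δ))) (hH : H = r / (1 - γ))
    (hβ : β = 100 * Fintype.card ι * H * √ζ) :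
    ∃ E : Set Ω, MeasurableSet E ∧ P Eᶜ ≤ ENNReal.ofReal (δ / 2) ∧ ∀ ω ∈ E,
      (∀ τ, |(D τ ω).2.1| ≤ r) ∧ ∀ w B' V, IsPenalizedMax Φ β (3 * H) (N * (3 * H)) w B' V →
        ∀ B, IsWhitening (fun τ => (Φ (D τ ω).1).ofLp) B → ∀ q,
          |(Φ q).ofLp ⬝ᵥ ridgeWeight γ Φ 1 (fun τ => D τ ω) V
            - (M.meanReward q + γ * M.next V q)| ≤ β * l2 (B *ᵥ (Φ q).ofLp) := by
  set d := Fintype.card ι with hd_def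
  have hΦ := hlin.2.1
  have h1' : 0 < 1 - γ := sub_pos.2 h1
  have hH0 : 0 < H := hH ▸ div_pos hr0 h1'
  have hrH : r + γ * H = H := by rw [hH]; field_simp; ring
  have hd1 : (1 : ℝ) ≤ d := by exact_mod_cast hd
  have hN1 : (1 : ℝ) ≤ N := by exact_mod_cast hN
  set mw := 6 * N ^ 2 * d with hmw
  set mB := ⌈200 * N * (d : ℝ) ^ 3 * √ζ⌉₊ with hmB
  obtain ⟨hζ1, hunion⟩ := union_bound_le (mw := mw) (mB := mB) hd hN h0 h1 hδ hδ1 rfl hζ hmw hmB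
  have hs1 : 1 ≤ √ζ := Real.one_le_sqrt.2 hζ1
  have hβ0 : 0 ≤ β := by rw [hβ]; positivity
  have hmBle : 200 * N * (d : ℝ) ^ 3 * √ζ ≤ mB := Nat.le_ceil _
  have hmB0' : (0 : ℝ) < mB := lt_of_lt_of_le (by positivity) hmBle
  have hmB0 : 0 < mB := by exact_mod_cast hmB0'
  -- Net precision `H / N`, half for the weights and half for the penalty matrix. This dictates the
  -- mesh `H / (2 N d)`, hence `mw` for weights up to `3 N H`, and the size of `mB`.
  have hε : d * (H / (2 * N * d)) + β * (d * (d * (1 / mB))) ≤ H / N := by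
    have e1 : d * (H / (2 * N * d)) = H / (2 * N) := by field_simp
    have e2 : β * (d * (d * (1 / mB))) ≤ H / (2 * N) := by
      have : β * (d * (d * (1 / mB))) = 100 * d ^ 3 * H * √ζ / mB := by rw [hβ]; ring
      rw [this, div_le_div_iff₀ hmB0' (by positivity)]
      have := mul_le_mul_of_nonneg_left hmBle hH0.le
      linarith
    have e3 : H / N = H / (2 * N) + H / (2 * N) := by field_simp; ring
    rw [e1, e3]
    linarith
  have hW : N * (3 * H) ≤ mw * (H / (2 * N * d)) := by
    rw [hmw]; push_cast
    refine le_of_eq ?_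
    field_simp
    ring
  obtain ⟨E, hEm, hEP, hE⟩ := exists_concentration_event (β := β) (K := 3 * H)
    (L := 121 * d ^ 2 * ζ) hlin.1 hΦ h0 h1.le hM hD hβ0 (by positivity) (by linarith) hd hmB0
    (by positivity : 0 < H / (2 * N * d)) hW (by positivity) hε
  refine ⟨E, hEm, hEP.trans (ENNReal.ofReal_le_ofReal hunion), fun ω hω => ⟨(hE ω hω).1,
    fun w B' V hV B hB q => ?_⟩⟩
  obtain ⟨u, hu, hux⟩ := hlin.exists_weight h0 hV.measurable (by positivity) hV.abs_le
  have hnoise := (hE ω hω).2 w B' V hV B hB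
  have herr := hB.abs_ridge_error_le (fun τ => (D τ ω).2.1 + γ * V (D τ ω).2.2) u.ofLp
    (Φ q).ofLp
  simp only [← inner_eq_dotProduct, ← hux] at herr
  rw [ridgeWeight, gram_one_eq_ridgeGram, hux, inner_eq_dotProduct]
  simp only [← inner_eq_dotProduct, ← hux] at herr ⊢
  refine herr.trans ?_
  rw [mul_comm]
  refine mul_le_mul_of_nonneg_right ?_ (l2_nonneg _)
  have hL : √(121 * d ^ 2 * ζ) = 11 * d * √ζ := by
    rw [Real.sqrt_mul (by positivity), show (121 * d ^ 2 : ℝ) = (11 * d) ^ 2 by ring,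
      Real.sqrt_sq (by positivity)]
  rw [hL] at hnoise
  have hu' : l2 u.ofLp ≤ 9 * (d * H) := by
    rw [l2_ofLp]
    refine hu.trans ?_
    have hsd : √(d : ℝ) ≤ d := Real.sqrt_le_iff.2 ⟨by linarith, by nlinarith⟩
    have hb : r + γ * (3 * (3 * H)) ≤ 9 * H := by linarith
    have := mul_le_mul hsd hb (by positivity) (by positivity)
    linarith
  have hNε : 4 * N * (H / N) = 4 * H := by field_simp
  rw [hNε] at hnoise
  have h3 : d * H ≤ d * H * √ζ := le_mul_of_one_le_right (by positivity) hs1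
  have h4 : H ≤ d * H := le_mul_of_one_le_left hH0.le hd1
  refine (add_le_add hnoise hu').trans ?_
  -- In units of `d H √ζ` the total is at most `82.5` (noise, from `5 / 2 · 3 · 11`), `4` (net), `3`
  -- (direction grid) and `9` (bias), which fits under `100`.
  rw [hβ]
  linarith

/-- Pessimistic value iteration on a linear MDP with adaptively collected data. -/
theorem pevi_guarantee {γ r δ ζ : ℝ} (h0 : 0 ≤ γ) (h1 : γ < 1) (hr0 : 0 ≤ r)
    (hδ : 0 < δ) (hδ1 : δ < 1) (hN : 0 < N) (hM : M.RewardBounded r)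
    (hlin : M.IsLinear Φ r) (hD : IsDatasetOf M P D)
    (hζ : ζ = Real.log (4 * Fintype.card ι * N / ((1 - γ) * δ)))
    (πstar : Kernel S A) [IsMarkovKernel πstar] (c : ℝ≥0)
    (hcov : ENNReal.ofReal (1 - δ / 2) ≤
      P {ω | ∀ s, coverage (M.policyCov γ Φ πstar s) (dataCov Φ fun τ => D τ ω) ≤ c}) :
    ∃ E : Set Ω, MeasurableSet E ∧ ENNReal.ofReal (1 - δ) ≤ P E ∧
      ∀ ω ∈ E, ∀ πhat : Kernel S A,
        IsPEVIOutput γ Φ 1 (100 * Fintype.card ι * r * √ζ / (1 - γ)) (fun τ => D τ ω) πhat →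
        ∀ s, M.J γ πstar s - M.J γ πhat s
          ≤ 200 * r / (1 - γ) ^ 2 * √(c * (Fintype.card ι : ℝ) ^ 3 * ζ / N) := by
  have h1' : 0 < 1 - γ := sub_pos.2 h1
  have hN' : (0 : ℝ) < N := by exact_mod_cast hN
  have hdpos : 0 < Fintype.card ι := by
    have : Nonempty Ω := nonempty_of_isProbabilityMeasure P
    exact hlin.card_pos (D ⟨0, hN⟩ this.some).1
  set d := Fintype.card ι with hd
  have hζ0 : 0 ≤ ζ :=
    zero_le_one.trans (union_bound_le hdpos hN h0 h1 hδ hδ1 rfl hζ rfl rfl).1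
  set R := √(c * (d : ℝ) ^ 3 * ζ / N) with hR
  have hR0 : 0 ≤ R := Real.sqrt_nonneg _
  -- In these cases the claim follows from the trivial bound `2 r / (1 - γ)` on any difference of
  -- returns. In the remaining case the discounted penalty along `π*` is at most `H`, as boundedness
  -- of the iterates requires.
  by_cases htriv : r = 0 ∨ 1 - γ ≤ 100 * R
  · refine ⟨Set.univ, MeasurableSet.univ, ?_, fun ω _ πhat hπ s => ?_⟩
    · rw [measure_univ, ← ENNReal.ofReal_one]
      exact ENNReal.ofReal_le_ofReal (by linarith)
    · have : IsMarkovKernel πhat := by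
        obtain ⟨_, _, _, _, _, _, _, h⟩ := hπ
        exact h.1
      refine (MDP.J_sub_le hM h0 h1 πstar πhat s).trans ?_
      rcases htriv with hr | hbig
      · rw [hr]; simp
      · have : 2 * r / (1 - γ) = 2 * r / (1 - γ) ^ 2 * (1 - γ) := by field_simp
        rw [this]
        calc _ ≤ 2 * r / (1 - γ) ^ 2 * (100 * R) :=
              mul_le_mul_of_nonneg_left hbig (by positivity)
          _ = _ := by ring
  · push Not at htriv
    obtain ⟨hrne, hsmall⟩ := htriv
    have hrpos : 0 < r := lt_of_le_of_ne hr0 hrne.symm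
    set H := r / (1 - γ) with hH
    have hH0 : 0 < H := div_pos hrpos h1'
    set β := 100 * d * r * √ζ / (1 - γ) with hβ
    have hβ' : β = 100 * d * H * √ζ := by rw [hβ, hH]; ring
    obtain ⟨E, hEm, hEP, hE⟩ := exists_accuracy_event h0 h1 hrpos hδ hδ1 hN hdpos hM hlin hD hζ
      hH hβ'
    set F := {ω | ∀ s, coverage (M.policyCov γ Φ πstar s) (dataCov Φ fun τ => D τ ω) ≤ c} with hF
    have hFm : MeasurableSet F := measurableSet_coverage_le hlin.1 hD.measurable _ c
    refine ⟨F ∩ E, hFm.inter hEm, ?_, fun ω hω πhat hπ s => ?_⟩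
    · have h2 : P F ≤ P (F ∩ E) + P Eᶜ := by
        rw [← measure_inter_add_sdiff F hEm]
        exact add_le_add le_rfl (measure_mono fun x hx => hx.2)
      have h3 : ENNReal.ofReal (1 - δ / 2) ≤ P (F ∩ E) + ENNReal.ofReal (δ / 2) :=
        hcov.trans (h2.trans (add_le_add le_rfl hEP))
      have h4 : ENNReal.ofReal (1 - δ) = ENNReal.ofReal (1 - δ / 2) - ENNReal.ofReal (δ / 2) := by
        rw [← ENNReal.ofReal_sub _ (by positivity)]
        congr 1
        ring
      rw [h4]
      exact tsub_le_iff_right.2 h3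
    · obtain ⟨hrew, hacc⟩ := hE ω hω.2
      obtain ⟨B, hB⟩ := exists_isWhitening fun τ => (Φ (D τ ω).1).ofLp
      have hrt : β * (√(c * d / N) / (1 - γ)) = 100 * r / (1 - γ) ^ 2 * R := by
        have : R = d * √ζ * √(c * d / N) := by
          rw [hR, show (c * (d : ℝ) ^ 3 * ζ / N : ℝ) = (d : ℝ) ^ 2 * (ζ * (c * d / N)) by ring,
            Real.sqrt_mul (by positivity), Real.sqrt_sq (by positivity), Real.sqrt_mul hζ0,
            mul_assoc]
        rw [this, hβ]
        field_simp
      have hpen : ∀ s, β * M.discounted γ πstar (fun q => l2 (B *ᵥ (Φ q).ofLp)) s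
          ≤ 100 * r / (1 - γ) ^ 2 * R := fun s => by
        rw [← hrt]
        exact mul_le_mul_of_nonneg_left (discounted_l2_whitening_le M h0 h1 πstar hlin.1 hlin.2.1
          hN (hω.1 s) hB) (by positivity)
      have hpenH : 100 * r / (1 - γ) ^ 2 * R ≤ H := by
        have : 100 * r / (1 - γ) ^ 2 * R = r / (1 - γ) ^ 2 * (100 * R) := by ring
        rw [this, hH]
        refine (mul_le_mul_of_nonneg_left hsmall.le (by positivity)).trans_eq ?_
        field_simp
      have := IsPEVIOutput.suboptimality_le h0 h1 hlin.1 hlin.2.1 hM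
        (by rw [hH]; field_simp; ring : r + γ * H = H) hH0.le hr0 (by positivity) hB hrew
        (fun w B' V hV q => hacc w B' V hV B hB q) (fun s => (hpen s).trans hpenH) hπ s
      refine this.trans ((mul_le_mul_of_nonneg_left (hpen s) zero_le_two).trans_eq ?_)
      ring

end Guarantee

/-! ### The hyper-MDP over a linear MDP. -/

section Rollout

open Matrix

variable {S A Z : Type*} [MeasurableSpace S] [MeasurableSpace A] [MeasurableSpace Z]
  (M : MDP S A) (b : Kernel (S × Z) A) [IsMarkovKernel b] (γ : ℝ)

theorem integral_primStep {f : ℝ × S → ℝ} (hf : Measurable f) {q : S × Z}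
    (hi : Integrable f (primStep M b q)) :
    ∫ p, f p ∂(primStep M b q) = ∫ a, ∫ p, f p ∂(M.step (q.1, a)) ∂(b q) := by
  rw [primStep, Kernel.integral_comp hi]
  exact integral_deterministic_prod b measurable_fst
    (measurable_integral_kernel M.step hf) q

theorem integral_rollout_succ {f : ℝ × S → ℝ} (hf : Measurable f) {n : ℕ} {q : S × Z}
    (hi : Integrable f (rollout M b γ (n + 1) q)) :
    ∫ p, f p ∂(rollout M b γ (n + 1) q)
      = ∫ p, ∫ p', f (p.1 + γ * p'.1, p'.2) ∂(rollout M b γ n (p.2, q.2)) ∂(primStep M b q) := by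
  have hg : Measurable fun q : (ℝ × S) × (ℝ × S) => (q.1.1 + γ * q.2.1, q.2.2) := by fun_prop
  rw [rollout, Kernel.map_apply _ hg] at hi ⊢
  rw [integral_map hg.aemeasurable hf.aestronglyMeasurable]
  exact integral_compProd
    ((integrable_map_measure hf.aestronglyMeasurable hg.aemeasurable).1 hi)

omit [IsMarkovKernel b] in
variable {M} in
theorem ae_primStep_abs_le {rmax : ℝ} (hM : M.RewardBounded rmax) (q : S × Z) :
    ∀ᵐ p ∂(primStep M b q), |p.1| ≤ rmax :=
  Kernel.ae_comp_of_ae_ae (measurableSet_le measurable_fst.abs measurable_const)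
    (ae_of_all _ fun x => hM x)

omit [IsMarkovKernel b] in
variable {M γ} in
theorem ae_rollout_abs_le (h0 : 0 ≤ γ) {rmax : ℝ} (hM : M.RewardBounded rmax) (n : ℕ)
    (q : S × Z) :
    ∀ᵐ p ∂(rollout M b γ n q), |p.1| ≤ (∑ k ∈ Finset.range n, γ ^ k) * rmax := by
  induction n generalizing q with
  | zero =>
    rw [rollout, Kernel.deterministic_apply, ae_dirac_iff
      (measurableSet_le measurable_fst.abs measurable_const)]
    simp
  | succ n ih =>
    have hg : Measurable fun q : (ℝ × S) × (ℝ × S) => (q.1.1 + γ * q.2.1, q.2.2) := by fun_prop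
    rw [rollout, Kernel.map_apply _ hg,
      ae_map_iff hg.aemeasurable (measurableSet_le measurable_fst.abs measurable_const)]
    refine Kernel.ae_compProd_of_ae_ae (measurableSet_le (by fun_prop) measurable_const) ?_
    filter_upwards [ae_primStep_abs_le b hM q] with p hp
    rw [Kernel.comap_apply]
    filter_upwards [ih (p.2, q.2)] with p' hp'
    refine (abs_add_le _ _).trans ((add_le_add hp ?_).trans_eq
      (b := rmax + γ * ((∑ k ∈ Finset.range n, γ ^ k) * rmax)) ?_)
    · rw [abs_mul, abs_of_nonneg h0]
      exact mul_le_mul_of_nonneg_left hp' h0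
    · rw [Finset.sum_range_succ']
      simp only [pow_succ', ← Finset.mul_sum, pow_zero]
      ring

theorem sum_pow_mul_eq_hyperRmax {γ : ℝ} (h1 : γ < 1) (c : ℕ) (rmax : ℝ) :
    (∑ k ∈ Finset.range c, γ ^ k) * rmax = hyperRmax γ c rmax := by
  rw [hyperRmax, geom_sum_eq h1.ne, ← neg_div_neg_eq, neg_sub, neg_sub]

variable {M γ} in
theorem MDP.RewardBounded.hyper (h0 : 0 ≤ γ) (h1 : γ < 1) {rmax : ℝ} (hM : M.RewardBounded rmax)
    (c : ℕ) : (hyper M b γ c).RewardBounded (hyperRmax γ c rmax) := fun q => by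
  rw [← sum_pow_mul_eq_hyperRmax h1]
  exact ae_rollout_abs_le b h0 hM c q

/-- The expected value of `h (·, z)` at the state reached from `(s, z)` after `n` steps. -/
noncomputable def afterSteps (n : ℕ) (h : S × Z → ℝ) (q : S × Z) : ℝ :=
  ∫ p, h (p.2, q.2) ∂(rollout M b γ n q)

/-- The expected value of `h (·, z)` after one step. -/
noncomputable def afterStep (h : S × Z → ℝ) (q : S × Z) : ℝ :=
  ∫ p, h (p.2, q.2) ∂(primStep M b q)

variable {h : S × Z → ℝ} {C : ℝ}

theorem measurable_afterSteps (n : ℕ) (hm : Measurable h) :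
    Measurable (afterSteps M b γ n h) :=
  measurable_integral_kernel_prod (rollout M b γ n)
    (f := fun x : (S × Z) × (ℝ × S) => h (x.2.2, x.1.2)) (by fun_prop)

theorem measurable_afterStep (hm : Measurable h) : Measurable (afterStep M b h) :=
  measurable_integral_kernel_prod (primStep M b)
    (f := fun x : (S × Z) × (ℝ × S) => h (x.2.2, x.1.2)) (by fun_prop)

theorem abs_afterSteps_le (n : ℕ) (hC : ∀ q, |h q| ≤ C) (q : S × Z) :
    |afterSteps M b γ n h q| ≤ C :=
  abs_integral_le_of_abs_le _ fun _ => hC _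

theorem abs_afterStep_le (hC : ∀ q, |h q| ≤ C) (q : S × Z) : |afterStep M b h q| ≤ C :=
  abs_integral_le_of_abs_le _ fun _ => hC _

omit [IsMarkovKernel b] in
theorem afterSteps_zero (hm : Measurable h) (q : S × Z) : afterSteps M b γ 0 h q = h q := by
  rw [afterSteps, rollout, Kernel.deterministic_apply, integral_dirac']
  have : Measurable fun p : ℝ × S => h (p.2, q.2) := by fun_prop
  exact this.stronglyMeasurable

theorem afterSteps_succ (n : ℕ) (hm : Measurable h) (hC : ∀ q, |h q| ≤ C) (q : S × Z) :
    afterSteps M b γ (n + 1) h q = afterStep M b (afterSteps M b γ n h) q := by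
  have hm' : Measurable fun p : ℝ × S => h (p.2, q.2) := by fun_prop
  rw [afterSteps, integral_rollout_succ M b γ hm' (integrable_of_abs_le _ hm' fun _ => hC _)]
  rfl

/-- Rollouts are built by prepending steps, whereas the transition law is linear in the feature of
the last step; this moves a step from the front to the end. -/
theorem afterSteps_afterStep (n : ℕ) (hm : Measurable h) (hC : ∀ q, |h q| ≤ C) (q : S × Z) :
    afterSteps M b γ n (afterStep M b h) q = afterSteps M b γ (n + 1) h q := by
  have hm' := measurable_afterStep M b hm
  have hC' := abs_afterStep_le M b hC
  induction n generalizing q with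
  | zero =>
    rw [afterSteps_zero M b γ hm', afterSteps_succ M b γ 0 hm hC]
    congr 1
    funext q
    exact (afterSteps_zero M b γ hm q).symm
  | succ n ih =>
    rw [afterSteps_succ M b γ n hm' hC', afterSteps_succ M b γ (n + 1) hm hC, funext ih]

theorem afterSteps_sum (n : ℕ) {κ : Type*} (I : Finset κ) {g : κ → S × Z → ℝ}
    (hm : ∀ k, Measurable (g k)) {C : κ → ℝ} (hC : ∀ k q, |g k q| ≤ C k) (a : κ → ℝ) (q : S × Z) :
    afterSteps M b γ n (fun q => ∑ k ∈ I, a k * g k q) q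
      = ∑ k ∈ I, a k * afterSteps M b γ n (g k) q := by
  rw [afterSteps, integral_finsetSum]
  · exact Finset.sum_congr rfl fun k _ => integral_const_mul _ _
  · intro k _
    have : Measurable fun p : ℝ × S => g k (p.2, q.2) := (hm k).comp (by fun_prop)
    exact (integrable_of_abs_le _ this fun _ => hC k _).const_mul _

/-- The expected reward of one step of the primitive. -/
noncomputable def primReward (q : S × Z) : ℝ := ∫ a, M.meanReward (q.1, a) ∂(b q)

theorem measurable_primReward : Measurable (primReward M b) :=
  measurable_integral_kernel_prod b (f := fun x : (S × Z) × A => M.meanReward (x.1.1, x.2))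
    (M.measurable_meanReward.comp (by fun_prop))

variable {M γ} in
theorem hyper_meanReward_eq (h0 : 0 ≤ γ) {rmax : ℝ} (hM : M.RewardBounded rmax) (n : ℕ)
    (q : S × Z) :
    (hyper M b γ n).meanReward q
      = ∑ k ∈ Finset.range n, γ ^ k * afterSteps M b γ k (primReward M b) q := by
  have hint : ∀ n q, Integrable (fun p : ℝ × S => p.1) (rollout M b γ n q) := fun n q =>
    Integrable.of_bound (by fun_prop) _ (ae_rollout_abs_le b h0 hM n q)
  have hint1 : ∀ q, Integrable (fun p : ℝ × S => p.1) (primStep M b q) := fun q =>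
    Integrable.of_bound (by fun_prop) _ (ae_primStep_abs_le b hM q)
  have hρm := measurable_primReward M b
  have hρb : ∀ q, |primReward M b q| ≤ rmax := fun q =>
    abs_integral_le_of_abs_le _ fun _ => hM.abs_meanReward_le _
  change ∫ p, p.1 ∂(rollout M b γ n q) = _
  induction n generalizing q with
  | zero =>
    rw [rollout, Kernel.deterministic_apply, integral_dirac' _ _ measurable_fst.stronglyMeasurable]
    simp
  | succ n ih =>
    rw [integral_rollout_succ M b γ measurable_fst (hint _ _)]
    -- Condition on the first step: its own reward plus `γ` times the mean reward of the remaining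
    -- `n` steps.
    have e1 : ∀ p : ℝ × S, ∫ p', (p.1 + γ * p'.1) ∂(rollout M b γ n (p.2, q.2))
        = p.1 + ∑ k ∈ Finset.range n,
          γ ^ (k + 1) * afterSteps M b γ k (primReward M b) (p.2, q.2) := fun p => by
      rw [integral_add (integrable_const _) ((hint _ _).const_mul _), integral_const_mul, ih,
        Finset.mul_sum]
      simp only [integral_const, probReal_univ, one_smul]
      congr 1
      exact Finset.sum_congr rfl fun k _ => by ring
    have hi : ∀ k, Integrable (fun p : ℝ × S =>
        γ ^ (k + 1) * afterSteps M b γ k (primReward M b) (p.2, q.2)) (primStep M b q) := fun k =>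
      (integrable_of_abs_le _ ((measurable_afterSteps M b γ k hρm).comp (by fun_prop))
        fun _ => abs_afterSteps_le M b γ k hρb _).const_mul _
    simp only [e1]
    rw [integral_add (hint1 q) (integrable_finsetSum _ fun k _ => hi k),
      integral_finsetSum _ fun k _ => hi k, Finset.sum_range_succ', add_comm]
    congr 1
    · refine Finset.sum_congr rfl fun k _ => ?_
      rw [integral_const_mul, afterSteps_succ M b γ k hρm hρb]
      rfl
    · rw [pow_zero, one_mul, afterSteps_zero M b γ hρm,
        integral_primStep M b measurable_fst (hint1 q)]
      rfl

theorem afterStep_comp_fst {f : S → ℝ} (hf : Measurable f) (hC : ∀ s, |f s| ≤ C) (q : S × Z) :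
    afterStep M b (fun x => f x.1) q = ∫ a, M.next f (q.1, a) ∂(b q) :=
  integral_primStep M b (hf.comp measurable_snd)
    (integrable_of_abs_le _ (hf.comp measurable_snd) fun _ => hC _)

variable {ι : Type*} {φ : S × A → EuclideanSpace ℝ ι}

/-- `E[φ(s, a)]` for `a` drawn from the primitive. -/
noncomputable def primMean (φ : S × A → EuclideanSpace ℝ ι) (i : ι) (q : S × Z) : ℝ :=
  ∫ a, φ (q.1, a) i ∂(b q)

variable [Fintype ι]

omit [Fintype ι] in
theorem measurable_primMean (hφm : Measurable φ) (i : ι) : Measurable (primMean b φ i) :=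
  measurable_integral_kernel_prod b (f := fun x : (S × Z) × A => φ (x.1.1, x.2) i)
    (by fun_prop)

theorem abs_primMean_le (hφ : ∀ q, ‖φ q‖ ≤ 1) (i : ι) (q : S × Z) : |primMean b φ i q| ≤ 1 :=
  abs_integral_le_of_abs_le _ fun a => (abs_apply_le_l2 (φ (q.1, a)).ofLp i).trans (hφ _)

theorem integral_inner_eq (hφm : Measurable φ) (hφ : ∀ q, ‖φ q‖ ≤ 1) (v : EuclideanSpace ℝ ι)
    (q : S × Z) :
    ∫ a, inner ℝ (φ (q.1, a)) v ∂(b q) = ∑ i, v i * primMean b φ i q := by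
  simp only [inner_eq_dotProduct, dotProduct]
  rw [integral_finsetSum]
  · refine Finset.sum_congr rfl fun i _ => ?_
    rw [integral_mul_const, mul_comm]
    rfl
  · intro i _
    have : Measurable fun a => φ (q.1, a) i := by fun_prop
    exact (integrable_of_abs_le _ this
      fun a => (abs_apply_le_l2 (φ (q.1, a)).ofLp i).trans (hφ _)).mul_const _

theorem afterSteps_integral_inner (hφm : Measurable φ) (hφ : ∀ q, ‖φ q‖ ≤ 1)
    (v : EuclideanSpace ℝ ι) (k : ℕ) (q : S × Z) :
    afterSteps M b γ k (fun q => ∫ a, inner ℝ (φ (q.1, a)) v ∂(b q)) q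
      = ∑ i, v i * primFeature M b γ φ k q i := by
  simp only [integral_inner_eq b hφm hφ v]
  exact afterSteps_sum M b γ k Finset.univ (measurable_primMean b hφm)
    (C := fun _ => 1) (abs_primMean_le b hφ) (fun i => v i) q

/-- Test the expected feature `v` against itself: `‖v‖²` is the expectation of `⟨φ, v⟩`, which is at
most `‖v‖`. -/
theorem l2_primFeature_le (hφm : Measurable φ) (hφ : ∀ q, ‖φ q‖ ≤ 1) (k : ℕ) (q : S × Z) :
    l2 (primFeature M b γ φ k q) ≤ 1 := by
  set v : EuclideanSpace ℝ ι := WithLp.toLp 2 (primFeature M b γ φ k q) with hv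
  have h1 := afterSteps_integral_inner M b γ hφm hφ v k q
  have h2 : ∑ i, v i * primFeature M b γ φ k q i = l2 (primFeature M b γ φ k q) ^ 2 :=
    dotProduct_self_eq _
  have h3 : |afterSteps M b γ k (fun q => ∫ a, inner ℝ (φ (q.1, a)) v ∂(b q)) q| ≤ ‖v‖ :=
    abs_afterSteps_le M b γ k (fun q => abs_integral_le_of_abs_le _ fun a =>
      (abs_real_inner_le_norm _ _).trans (mul_le_of_le_one_left (norm_nonneg _) (hφ _))) q
  have h4 : ‖v‖ = l2 (primFeature M b γ φ k q) := rfl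
  rw [h1, h2, h4, abs_of_nonneg (sq_nonneg _)] at h3
  nlinarith [l2_nonneg (primFeature M b γ φ k q)]

omit [Fintype ι] in
theorem measurable_hyperFeature (hφm : Measurable φ) (c : ℕ) :
    Measurable (hyperFeature M b γ c φ) := by
  have hp : ∀ k i, Measurable fun q => primFeature M b γ φ k q i := fun k i =>
    measurable_afterSteps M b γ k (measurable_primMean b hφm i)
  refine (WithLp.measurable_toLp 2 _).comp (measurable_pi_lambda _ fun i => ?_)
  rcases i with i | i
  · exact (hp _ i).div_const _
  · exact ((Finset.measurable_sum _ fun k _ => (hp k i).const_mul _).const_mul _).div_const _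

theorem norm_toLp_sum_elim_sq {κ : Type*} [Fintype κ] (u : ι → ℝ) (v : κ → ℝ) :
    ‖(WithLp.toLp 2 (Sum.elim u v) : EuclideanSpace ℝ (ι ⊕ κ))‖ ^ 2 = l2 u ^ 2 + l2 v ^ 2 := by
  rw [EuclideanSpace.real_norm_sq_eq, Fintype.sum_sum_type, ← dotProduct_self_eq,
    ← dotProduct_self_eq]
  simp [dotProduct, sq]

variable {γ}

/-- The weights `(1 - γ) γ ^ k / (1 - γ ^ c)` sum to one, so each block has norm at most `1` before
the factor `1 / √2` is applied. -/
theorem norm_hyperFeature_le (h0 : 0 ≤ γ) (h1 : γ < 1) (hφm : Measurable φ)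
    (hφ : ∀ q, ‖φ q‖ ≤ 1) {c : ℕ} (hc : 1 ≤ c) (q : S × Z) :
    ‖hyperFeature M b γ c φ q‖ ≤ 1 := by
  have h1' : 0 < 1 - γ := sub_pos.2 h1
  have hgc : 0 < 1 - γ ^ c := sub_pos.2 (pow_lt_one₀ h0 h1 (by omega))
  set u := primFeature M b γ φ (c - 1) q with hu
  set x : ι → ℝ := ((1 - γ) / (1 - γ ^ c)) •
    ∑ k ∈ Finset.range c, γ ^ k • primFeature M b γ φ k q with hx
  have hx1 : l2 x ≤ 1 := by
    rw [hx, l2_smul, abs_of_pos (div_pos h1' hgc)]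
    have h2 : l2 (∑ k ∈ Finset.range c, γ ^ k • primFeature M b γ φ k q)
        ≤ (1 - γ ^ c) / (1 - γ) := by
      refine (l2_sum_le _ _).trans ((Finset.sum_le_sum (g := fun k => γ ^ k)
        fun k _ => ?_).trans_eq ?_)
      · rw [l2_smul, abs_of_nonneg (pow_nonneg h0 k)]
        exact mul_le_of_le_one_right (pow_nonneg h0 k) (l2_primFeature_le M b γ hφm hφ k q)
      · have := sum_pow_mul_eq_hyperRmax h1 c 1
        rwa [mul_one, hyperRmax, mul_one] at this
    refine (mul_le_mul_of_nonneg_left h2 (div_pos h1' hgc).le).trans_eq ?_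
    field_simp
  have hu1 : l2 u ≤ 1 := l2_primFeature_le M b γ hφm hφ _ q
  have heq : hyperFeature M b γ c φ q
      = WithLp.toLp 2 (Sum.elim ((√2)⁻¹ • u) ((√2)⁻¹ • x)) := by
    rw [hyperFeature]
    congr 2
    · funext i
      simp [hu, div_eq_inv_mul]
    · funext i
      simp [hx, div_eq_inv_mul]
  have hsq : ((√2)⁻¹ : ℝ) ^ 2 = 1 / 2 := by rw [inv_pow, Real.sq_sqrt zero_le_two]; norm_num
  have hnorm := norm_toLp_sum_elim_sq ((√2)⁻¹ • u) ((√2)⁻¹ • x)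
  rw [← heq, l2_smul, l2_smul, mul_pow, mul_pow, sq_abs, hsq] at hnorm
  have := pow_le_one₀ (n := 2) (l2_nonneg u) hu1
  have := pow_le_one₀ (n := 2) (l2_nonneg x) hx1
  exact (sq_le_one_iff₀ (norm_nonneg _)).1 (by linarith)

variable {M}

/-- The hyper-MDP over a linear MDP is a linear MDP. -/
theorem MDP.IsLinear.hyper (h0 : 0 ≤ γ) (h1 : γ < 1) {rmax : ℝ} (h0r : 0 ≤ rmax) {c : ℕ}
    (hc : 1 ≤ c) (hM : M.RewardBounded rmax) (hlin : M.IsLinear φ rmax) :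
    (hyper M b γ c).IsLinear (hyperFeature M b γ c φ) (hyperRmax γ c rmax) := by
  obtain ⟨hφm, hφ, ⟨μ, hμb, hμ⟩, θ, hθ, hr⟩ := hlin
  have h1' : 0 < 1 - γ := sub_pos.2 h1
  have hgc : 0 < 1 - γ ^ c := sub_pos.2 (pow_lt_one₀ h0 h1 (by omega))
  have hs2 : (0 : ℝ) < √2 := Real.sqrt_pos.2 zero_lt_two
  have hl0 : l2 (0 : ι → ℝ) = 0 := by simp [l2]
  have hcard : √(Fintype.card (ι ⊕ ι) : ℝ) = √2 * √(Fintype.card ι) := by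
    rw [← Real.sqrt_mul zero_le_two, Fintype.card_sum]
    push_cast
    congr 1
    ring
  refine ⟨measurable_hyperFeature M b γ hφm c, norm_hyperFeature_le M b h0 h1 hφm hφ hc, ?_, ?_⟩
  · let inj : EuclideanSpace ℝ ι →+ EuclideanSpace ℝ (ι ⊕ ι) :=
      { toFun := fun v => WithLp.toLp 2 (Sum.elim (√2 • v.ofLp) 0)
        map_zero' := by
          ext i
          rcases i with i | i <;> simp
        map_add' := fun v w => by
          ext i
          rcases i with i | i <;> simp }
    have hinj : Continuous inj := by
      refine (PiLp.continuous_toLp 2 _).comp (continuous_pi fun i => ?_)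
      rcases i with i | i
      · simp only [Sum.elim_inl, Pi.smul_apply]
        fun_prop
      · exact continuous_const
    refine ⟨μ.mapRange inj hinj, fun B hB => ?_, fun q B hB => ?_⟩
    · rw [VectorMeasure.mapRange_apply, hcard]
      refine abs_le_of_sq_le_sq' ?_ (by positivity) |>.2
      change ‖(WithLp.toLp 2 (Sum.elim (√2 • (μ B).ofLp) 0) : EuclideanSpace ℝ (ι ⊕ ι))‖ ^ 2 ≤ _
      rw [norm_toLp_sum_elim_sq, hl0, l2_smul, abs_of_pos hs2, l2_ofLp]
      have := pow_le_pow_left₀ (by positivity) (mul_le_mul_of_nonneg_left (hμb B hB) hs2.le) 2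
      linarith
    -- `c ≥ 1` makes `c - 1` a genuine predecessor: `n` steps reach the last state-action pair, and
    -- one more transition reaches `B`.
    · obtain ⟨n, rfl⟩ : ∃ n, c = n + 1 := ⟨c - 1, by omega⟩
      set f : S → ℝ := B.indicator fun _ => 1 with hf
      have hfm : Measurable f := measurable_const.indicator hB
      have hfb : ∀ s, |f s| ≤ 1 := fun s => by
        rw [hf]
        by_cases hs : s ∈ B <;> simp [hs]
      have e1 : ((HierRL.hyper M b γ (n + 1)).step q).real (Prod.snd ⁻¹' B)
          = afterSteps M b γ (n + 1) (fun x => f x.1) q := by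
        rw [← integral_indicator_one (measurable_snd hB)]
        rfl
      have e2 : ∀ x : S × A, M.next f x = inner ℝ (φ x) (μ B) := fun x => by
        rw [← hμ x B hB, ← integral_indicator_one (measurable_snd hB)]
        rfl
      have e3 : afterStep M b (fun x => f x.1)
          = fun q => ∫ a, inner ℝ (φ (q.1, a)) (μ B) ∂(b q) := by
        funext q
        rw [afterStep_comp_fst M b hfm hfb]
        simp only [e2]
      rw [e1, ← afterSteps_afterStep M b γ n (h := fun x => f x.1)
        (hfm.comp measurable_fst) (fun q => hfb q.1), e3,
        afterSteps_integral_inner M b γ hφm hφ, inner_eq_dotProduct, VectorMeasure.mapRange_apply]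
      simp only [hyperFeature, dotProduct, Fintype.sum_sum_type]
      simp only [inj, AddMonoidHom.coe_mk, ZeroHom.coe_mk, Sum.elim_inl, Sum.elim_inr,
        Pi.smul_apply, Pi.zero_apply, mul_zero, Finset.sum_const_zero, add_zero, smul_eq_mul,
        Nat.add_sub_cancel]
      refine Finset.sum_congr rfl fun i _ => ?_
      field_simp
  -- The reward vector goes into the second block; `a` undoes both `1 / √2` and the normalisation of
  -- the discounted feature.
  · set a : ℝ := √2 * ((1 - γ ^ c) / (1 - γ)) with ha
    have ha0 : 0 ≤ a := by positivity
    refine ⟨WithLp.toLp 2 (Sum.elim 0 (a • θ.ofLp)), ?_, fun q => ?_⟩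
    · rw [hcard]
      have hb : 0 ≤ hyperRmax γ c rmax := by
        rw [hyperRmax]; positivity
      refine abs_le_of_sq_le_sq' ?_ (by positivity) |>.2
      rw [norm_toLp_sum_elim_sq, hl0, l2_smul, abs_of_nonneg ha0, l2_ofLp]
      have := pow_le_pow_left₀ (by positivity) (mul_le_mul_of_nonneg_left hθ ha0) 2
      have h3 : a * (√(Fintype.card ι) * rmax)
          = √2 * √(Fintype.card ι) * hyperRmax γ c rmax := by
        rw [ha, hyperRmax]; ring
      rw [h3] at this
      linarith
    · have e1 : primReward M b = fun q => ∫ a, inner ℝ (φ (q.1, a)) θ ∂(b q) := by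
        funext q
        simp only [primReward, hr]
      rw [hyper_meanReward_eq b h0 hM, e1, inner_eq_dotProduct]
      simp only [afterSteps_integral_inner M b γ hφm hφ, hyperFeature, dotProduct,
        Fintype.sum_sum_type, Sum.elim_inl, Sum.elim_inr, Pi.smul_apply, Pi.zero_apply, mul_zero,
        Finset.sum_const_zero, zero_add, smul_eq_mul, Finset.mul_sum]
      rw [Finset.sum_comm]
      refine Finset.sum_congr rfl fun i _ => ?_
      rw [Finset.sum_div, Finset.sum_mul]
      refine Finset.sum_congr rfl fun k _ => ?_
      rw [ha]
      field_simp

end Rollout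

end HierRL

theorem lemma2 :
    -- the guarantee, with one absolute constant `C`
    (∃ C : ℝ, 0 < C ∧
      ∀ (S A Z Ω ι : Type*) [MeasurableSpace S] [MeasurableSpace A] [MeasurableSpace Z]
        [MeasurableSpace Ω] [Fintype ι] [DecidableEq ι]
        (M : HierRL.MDP S A) (b : Kernel (S × Z) A) [IsMarkovKernel b]
        (γ rmax δ : ℝ) (c N : ℕ) (Φ : S × Z → EuclideanSpace ℝ ι)
        (πstar : Kernel S Z) [IsMarkovKernel πstar]
        (P : Measure Ω) [IsProbabilityMeasure P] (D : Fin N → Ω → HierRL.Transition S Z)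
        (cdag : ℝ≥0),
        0 ≤ γ → γ < 1 → 0 ≤ rmax → 0 < δ → δ < 1 → 1 ≤ c → 1 ≤ N →
        M.RewardBounded rmax →
        (HierRL.hyper M b γ c).IsLinear Φ (HierRL.hyperRmax γ c rmax) →
        (HierRL.hyper M b γ c).IsOptimal (γ ^ c) πstar →
        HierRL.IsDatasetOf (HierRL.hyper M b γ c) P D →
        ENNReal.ofReal (1 - δ / 2) ≤
          P {ω | ∀ s, HierRL.coverage ((HierRL.hyper M b γ c).policyCov (γ ^ c) Φ πstar s)
            (HierRL.dataCov Φ (fun τ => D τ ω)) ≤ cdag} →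
        ∃ E : Set Ω, MeasurableSet E ∧ ENNReal.ofReal (1 - δ) ≤ P E ∧
          ∀ ω ∈ E, ∀ πhat : Kernel S Z,
            HierRL.IsPEVIOutput (γ ^ c) Φ 1
              (C * Fintype.card ι * HierRL.hyperRmax γ c rmax *
                √(HierRL.zeta (Fintype.card ι) N γ c δ) / (1 - γ ^ c))
              (fun τ => D τ ω) πhat →
            ∀ s, (HierRL.hyper M b γ c).J (γ ^ c) πstar s -
                (HierRL.hyper M b γ c).J (γ ^ c) πhat s ≤
              2 * C * rmax / ((1 - γ) * (1 - γ ^ c)) *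
                √(cdag * (Fintype.card ι : ℝ) ^ 3 *
                  HierRL.zeta (Fintype.card ι) N γ c δ / N)) ∧
    -- if `M` is a linear MDP, the hyper-MDP is one, with the inherited features
    (∀ (S A Z ι : Type*) [MeasurableSpace S] [MeasurableSpace A] [MeasurableSpace Z] [Fintype ι]
        (M : HierRL.MDP S A) (b : Kernel (S × Z) A) [IsMarkovKernel b]
        (γ rmax : ℝ) (c : ℕ) (φ : S × A → EuclideanSpace ℝ ι),
        0 ≤ γ → γ < 1 → 0 ≤ rmax → 1 ≤ c → M.RewardBounded rmax → M.IsLinear φ rmax →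
        (HierRL.hyper M b γ c).IsLinear (HierRL.hyperFeature M b γ c φ)
          (HierRL.hyperRmax γ c rmax)) := by
  refine ⟨⟨100, by norm_num, ?_⟩, ?_⟩
  · intro S A Z Ω ι _ _ _ _ _ _ M b _ γ rmax δ c N Φ πstar _ P _ D cdag h0 h1 hr hδ hδ1 hc hN hM
      hlin _ hD hcov
    have hg0 : 0 ≤ γ ^ c := pow_nonneg h0 c
    have hg1 : γ ^ c < 1 := pow_lt_one₀ h0 h1 (by omega)
    have h1' : 0 < 1 - γ := sub_pos.2 h1
    have hg1' : 0 < 1 - γ ^ c := sub_pos.2 hg1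
    have hr' : 0 ≤ HierRL.hyperRmax γ c rmax := by
      rw [HierRL.hyperRmax]; positivity
    obtain ⟨E, hEm, hEP, hE⟩ := HierRL.pevi_guarantee hg0 hg1 hr' hδ hδ1 hN
      (hM.hyper b h0 h1 c) hlin hD (ζ := HierRL.zeta (Fintype.card ι) N γ c δ) rfl πstar cdag hcov
    refine ⟨E, hEm, hEP, fun ω hω πhat hπ s => (hE ω hω πhat hπ s).trans_eq ?_⟩
    congr 1
    -- The factor `1 - γ ^ c` in the hyper-reward bound cancels one of the two effective horizons `1
    -- / (1 - γ ^ c)`.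
    rw [HierRL.hyperRmax]
    field_simp
    ring
  · intro S A Z ι _ _ _ _ M b _ γ rmax c φ h0 h1 hr hc hM hlin
    exact hlin.hyper b h0 h1 hr hc hM
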